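/- Let $\ell>0$. All functions are complex-valued. An \emph{impedance} is a function $f\in W^{1,2}(0,\ell)\subset C[0,\ell]$ (absolutely continuous on $[0,\ell]$ with $f'\in L^2(0,\ell)$) that does not vanish on $[0,\ell]$ and satisfies $f(0)=1$. For an impedance $f$ put $$\sigma_f(x)=\frac{f'(x)}{f(x)}+\int_0^x\Big(\frac{f'(t)}{f(t)}\Big)^2dt,\qquad (q_f\,|\,\varphi)=\int_0^\ell\Big\{\Big(\frac{f'}{f}\Big)^2\varphi-\frac{f'}{f}\varphi'\Big\}dx\quad(\varphi\in W^{1,2}_0(0,\ell)),$$ so that $q_f=f''/f=\sigma_f'\in W^{-1,2}(0,\ell)$, and $\mathbf D_fy=y'-\frac{f'}{f}y$. For $\rho\in\mathbb C$ let $e_f(\rho,\cdot)\in W^{1,2}(0,\ell)$ be the unique solution of $$-y''+q_fy=\rho^2y\ \text{ on }(0,\ell),\qquad y(0)=1,\quad \mathbf D_fy(0)=i\rho,$$ where the equation means $\int_0^\ell y'\varphi'\,dx+(q_f\,|\,y\varphi)=\rho^2\int_0^\ell y\varphi\,dx$ for all $\varphi\in W^{1,2}_0(0,\ell)$; for such $y$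 the function $\mathbf D_fy$ belongs to $W^{1,2}(0,\ell)$, and its value at $0$ is that of its continuous representative. Let $\mathcal T_\ell=\{(x,t)\in\mathbb R^2: 0\le x\le\ell,\ |t|\le x\}$. For every impedance $f$ let $K_f\in L^2(\mathcal T_\ell)$, with $K_f(x,\cdot)\in L^2(-x,x)$ for every $x\in(0,\ell]$, be the kernel such that $$e_f(\rho,x)=e^{i\rho x}+\int_{-x}^{x}K_f(x,t)e^{i\rho t}\,dt\qquad(\rho\in\mathbb C,\ 0<x\le\ell),$$ and let $$\mathbf T_fu(x)=u(x)+\int_{-x}^xK_f(x,t)u(t)\,dt .$$ Let $f$ be an impedance and let $f_n\in C^\infty[0,\ell]$, $n\in\mathbb N$, be impedances such that $$f_n\to f\ \text{ and }\ \tfrac1{f_n}\to\tfrac1f\ \text{ in }W^{1,2}(0,\ell),\qquad \sigma_{f_n}\to\sigma_f\ \text{ in }L^2(0,\ell),\qquad q_{f_n}\to q_f\ \text{ in }W^{-1,2}(0,\ell).$$ Then the kernels $K_f$ and $K_{f_n}$ exist and are unique (for each $x\in(0,\ell]$, up to equality for almost every $t\in(-x,x)$), the operators $\mathbf T_f,\mathbf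 T_{f_n}$ belong to $\mathcal B(L^2(-\ell,\ell),L^2(0,\ell))$ and to $\mathcal B(C[-\ell,\ell],C[0,\ell])$, and $$\mathbf T_{f_n}\to\mathbf T_f\ \text{ in the strong operator topology of }\mathcal B(L^2(-\ell,\ell),L^2(0,\ell))\text{ and of }\mathcal B(C[-\ell,\ell],C[0,\ell]),$$ that is, $\mathbf T_{f_n}u\to\mathbf T_fu$ in $L^2(0,\ell)$ for every $u\in L^2(-\ell,\ell)$, and uniformly on $[0,\ell]$ for every $u\in C[-\ell,\ell]$. Moreover $K_{f_n}\rightharpoonup K_f$ weakly in $L^2(\mathcal T_\ell)$. -/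

import Mathlib

open MeasureTheory Set Filter Topology
open scoped ContDiff

noncomputable section

namespace Transmutation

/-- Lebesgue measure on the open interval `(0, ℓ)`. -/
abbrev μ₀ (ℓ : ℝ) : Measure ℝ := volume.restrict (Ioo 0 ℓ)

/-- Lebesgue measure on the open interval `(-ℓ, ℓ)`. -/
abbrev μ₁ (ℓ : ℝ) : Measure ℝ := volume.restrict (Ioo (-ℓ) ℓ)

/-- The closed triangle `0 ≤ x ≤ ℓ`, `|t| ≤ x`; points are pairs `(x, t)`. -/
def triangle (ℓ : ℝ) : Set (ℝ × ℝ) := {p | 0 ≤ p.1 ∧ p.1 ≤ ℓ ∧ |p.2| ≤ p.1}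

/-- Lebesgue measure on the triangle. -/
abbrev μT (ℓ : ℝ) : Measure (ℝ × ℝ) := volume.restrict (triangle ℓ)

/-! ### Sobolev spaces on `(0, ℓ)` -/

/-- `u` restricted to `[0, ℓ]` is (the continuous representative of) an element of
`W^{1,2}(0, ℓ)`: it is absolutely continuous on `[0, ℓ]` and its derivative, which exists
almost everywhere, is square integrable. -/
structure MemW12 (ℓ : ℝ) (u : ℝ → ℂ) : Prop where
  ac : AbsolutelyContinuousOnInterval u 0 ℓ
  deriv_memLp : MemLp (deriv u) 2 (μ₀ ℓ)

/-- `W₀^{1,2}(0, ℓ)`: the elements of `W^{1,2}(0, ℓ)` that vanish at both end points. -/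
structure MemW12Zero (ℓ : ℝ) (φ : ℝ → ℂ) : Prop where
  memW12 : MemW12 ℓ φ
  left : φ 0 = 0
  right : φ ℓ = 0

/-- The norm of `W^{1,2}(0, ℓ)`. -/
def w12Norm (ℓ : ℝ) (u : ℝ → ℂ) : ℝ :=
  Real.sqrt ((eLpNorm u 2 (μ₀ ℓ)).toReal ^ 2 + (eLpNorm (deriv u) 2 (μ₀ ℓ)).toReal ^ 2)

/-- Convergence `u n → v` in the norm of `L²(0, ℓ)`. -/
def TendstoL2 (ℓ : ℝ) (u : ℕ → ℝ → ℂ) (v : ℝ → ℂ) : Prop :=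
  Tendsto (fun n => eLpNorm (fun x => u n x - v x) 2 (μ₀ ℓ)) atTop (𝓝 0)

/-- Convergence `u n → v` in the norm of `W^{1,2}(0, ℓ)`. -/
def TendstoW12 (ℓ : ℝ) (u : ℕ → ℝ → ℂ) (v : ℝ → ℂ) : Prop :=
  TendstoL2 ℓ u v ∧ TendstoL2 ℓ (fun n => deriv (u n)) (deriv v)

/-- Convergence `q n → p` of functionals on `W₀^{1,2}(0, ℓ)` in the norm of the dual space
`W^{-1,2}(0, ℓ)`. -/
def TendstoWNeg12 (ℓ : ℝ) (q : ℕ → (ℝ → ℂ) → ℂ) (p : (ℝ → ℂ) → ℂ) : Prop :=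
  ∀ ε : ℝ, 0 < ε → ∀ᶠ n in atTop, ∀ φ : ℝ → ℂ, MemW12Zero ℓ φ →
    ‖q n φ - p φ‖ ≤ ε * w12Norm ℓ φ

/-! ### Impedances, the distributional potential `f''/f`, and the Schrödinger equation -/

/-- `f ∈ W^{1,2}(0, ℓ)` does not vanish on `[0, ℓ]` and is normalized by `f 0 = 1`. -/
structure IsImpedance (ℓ : ℝ) (f : ℝ → ℂ) : Prop where
  memW12 : MemW12 ℓ f
  ne_zero : ∀ x ∈ Icc 0 ℓ, f x ≠ 0
  normalized : f 0 = 1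

/-- The logarithmic derivative `f'/f`. -/
def logD (f : ℝ → ℂ) (x : ℝ) : ℂ := deriv f x / f x

/-- The antiderivative `σ_f = f'/f + ∫₀ˣ (f'/f)²` of the potential `f''/f`. -/
def sigma (f : ℝ → ℂ) (x : ℝ) : ℂ := logD f x + ∫ t in (0 : ℝ)..x, logD f t ^ 2

/-- The distribution `q_f = f''/f ∈ W^{-1,2}(0, ℓ)`:
`(q_f | φ) = ∫ (f'/f)² φ - (f'/f) φ'` for `φ ∈ W₀^{1,2}(0, ℓ)`. -/
def potential (ℓ : ℝ) (f φ : ℝ → ℂ) : ℂ :=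
  ∫ x in (0 : ℝ)..ℓ, (logD f x ^ 2 * φ x - logD f x * deriv φ x)

/-- The distribution `S_f y = -y'' + q_f y`:
`(S_f y | φ) = ∫ y' φ' + (q_f | y φ)` for `φ ∈ W₀^{1,2}(0, ℓ)`. -/
def schrodinger (ℓ : ℝ) (f y φ : ℝ → ℂ) : ℂ :=
  (∫ x in (0 : ℝ)..ℓ, deriv y x * deriv φ x) + potential ℓ f (fun x => y x * φ x)

/-- `D_f y = y' - (f'/f) y`. -/
def quasiDeriv (f y : ℝ → ℂ) (x : ℝ) : ℂ := deriv y x - logD f x * y x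

/-- `y` is the solution `e_f(ρ, ·)` of the Cauchy problem `-y'' + q_f y = ρ² y` on `(0, ℓ)`,
`y 0 = 1`, `(D_f y) 0 = iρ`. The value of `D_f y` at `0` is that of its continuous
representative `w`. -/
structure IsExpSolution (ℓ : ℝ) (f : ℝ → ℂ) (ρ : ℂ) (y : ℝ → ℂ) : Prop where
  memW12 : MemW12 ℓ y
  equation : ∀ φ : ℝ → ℂ, MemW12Zero ℓ φ →
    schrodinger ℓ f y φ = ∫ x in (0 : ℝ)..ℓ, ρ ^ 2 * y x * φ x
  init : y 0 = 1
  init_quasi : ∃ w : ℝ → ℂ, MemW12 ℓ w ∧ w =ᵐ[μ₀ ℓ] quasiDeriv f y ∧ w 0 = Complex.I * ρ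

/-! ### The transmutation kernel and operator -/

/-- `K ∈ L²(𝒯_ℓ)`, with slices `K(x, ·) ∈ L²(-x, x)`, represents the solutions `e_f(ρ, ·)`:
`e_f(ρ, x) = exp(iρx) + ∫_{-x}^{x} K(x, t) exp(iρt) dt` for all `ρ ∈ ℂ`, `x ∈ (0, ℓ]`. -/
structure IsTransmutationKernel (ℓ : ℝ) (f : ℝ → ℂ) (K : ℝ → ℝ → ℂ) : Prop where
  memLp : MemLp (fun p : ℝ × ℝ => K p.1 p.2) 2 (μT ℓ)
  slice : ∀ x ∈ Ioc 0 ℓ, MemLp (K x) 2 (μ₁ x)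
  representation : ∀ ρ : ℂ, ∃ y : ℝ → ℂ, IsExpSolution ℓ f ρ y ∧
    ∀ x ∈ Ioc 0 ℓ, y x = Complex.exp (Complex.I * ρ * x) +
      ∫ t in (-x)..x, K x t * Complex.exp (Complex.I * ρ * t)

/-- `K` is a transmutation kernel for `f`, and the only one up to null sets in `t`. -/
def IsUniqueTransmutationKernel (ℓ : ℝ) (f : ℝ → ℂ) (K : ℝ → ℝ → ℂ) : Prop :=
  IsTransmutationKernel ℓ f K ∧
    ∀ K' : ℝ → ℝ → ℂ, IsTransmutationKernel ℓ f K' → ∀ x ∈ Ioc 0 ℓ, K' x =ᵐ[μ₁ x] K x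

/-- The transmutation kernel `K_f`. -/
def kernel (ℓ : ℝ) (f : ℝ → ℂ) : ℝ → ℝ → ℂ := Classical.epsilon (IsTransmutationKernel ℓ f)

/-- `T_f u (x) = u(x) + ∫_{-x}^{x} K_f(x, t) u(t) dt`. -/
def transmute (ℓ : ℝ) (f u : ℝ → ℂ) (x : ℝ) : ℂ := u x + ∫ t in (-x)..x, kernel ℓ f x t * u t

/-- `T` is the operator `T_f` as an element of `B(L²(-ℓ, ℓ), L²(0, ℓ))`. -/
def IsTransmutationL2 (ℓ : ℝ) (f : ℝ → ℂ)
    (T : Lp ℂ 2 (μ₁ ℓ) →L[ℂ] Lp ℂ 2 (μ₀ ℓ)) : Prop :=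
  ∀ u : Lp ℂ 2 (μ₁ ℓ), T u =ᵐ[μ₀ ℓ] transmute ℓ f u

/-- `S` is the operator `T_f` as an element of `B(C[-ℓ, ℓ], C[0, ℓ])`. -/
def IsTransmutationC (ℓ : ℝ) (hℓ : 0 < ℓ) (f : ℝ → ℂ)
    (S : C(Icc (-ℓ) ℓ, ℂ) →L[ℂ] C(Icc (0 : ℝ) ℓ, ℂ)) : Prop :=
  ∀ (u : C(Icc (-ℓ) ℓ, ℂ)) (x : Icc (0 : ℝ) ℓ),
    S u x = transmute ℓ f (IccExtend (neg_le_self hℓ.le) u) x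

/-- `F n → f` in the sense that `F n → f` and `1/F n → 1/f` in `W^{1,2}(0, ℓ)`,
`σ_{F n} → σ_f` in `L²(0, ℓ)` and `q_{F n} → q_f` in `W^{-1,2}(0, ℓ)`. -/
structure ImpedanceTendsto (ℓ : ℝ) (F : ℕ → ℝ → ℂ) (f : ℝ → ℂ) : Prop where
  tendsto : TendstoW12 ℓ F f
  tendsto_inv : TendstoW12 ℓ (fun n x => (F n x)⁻¹) (fun x => (f x)⁻¹)
  tendsto_sigma : TendstoL2 ℓ (fun n => sigma (F n)) (sigma f)
  tendsto_potential : TendstoWNeg12 ℓ (fun n => potential ℓ (F n)) (potential ℓ f)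

end Transmutation

end

/-!
Put `a = f'/f ∈ L²(0, ℓ)`. With `w = D_f y` the Schrödinger equation becomes the system
`y' = a y + w`, `w' = -a w - ρ² y`, in which `q_f` no longer appears. If `z_a(ρ)` solves
`z(ρ)' = iρ z(ρ) + a z(-ρ)`, `z(ρ)(0) = 1`, then the even part in `ρ` of `z_a` and the odd part of
`z_{-a}` are the components `y` of the solutions of the system with `(y, w)(0) = (1, 0)` and
`(0, iρ)`, so `e_f(ρ, ·)` is their sum. Integrating the equation of `z` shows that
`z_a(ρ)(x) = exp (iρx) + ∫ S(x, t) exp (iρt) dt` as soon as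
`S(x, t) = a((x - t)/2)/2 + ∫₀ˣ a(s) S(s, x - s - t) ds`.

The Volterra operator on the right maps kernels that are square integrable along characteristics to
bounded kernels, and is a contraction in norms with weight `exp (-c x)`, `c` depending only on
`‖a‖₂`. Hence the Neumann series for `S` converges, and `a ↦ S(x, ·) ∈ L²(-x, x)` is Lipschitz on
bounded sets of coefficients, uniformly in `x ≤ ℓ`. Exponentials span a dense subspace of
`L²(-x, x)`, which gives uniqueness of the kernel and continuity of `∫ K(·, t) u(t) dt` for
every `u`. Since `f_n' → f'` in `L²` and `f_n(0) = f(0)` force `f_n'/f_n → f'/f` in `L²`, the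
kernels and the operators converge even in norm.
-/

noncomputable section

namespace Transmutation

/-! ### Absolutely continuous functions and `W^{1,2}(0, ℓ)` -/

section AbsolutelyContinuous

variable {a b : ℝ}

theorem absolutelyContinuousOnInterval_of_dist_le {X Y : Type*} [PseudoMetricSpace X]
    [PseudoMetricSpace Y] {f : ℝ → X} {g : ℝ → Y} (hg : AbsolutelyContinuousOnInterval g a b)
    (h : ∀ x ∈ uIcc a b, ∀ y ∈ uIcc a b, dist (f x) (f y) ≤ dist (g x) (g y)) :
    AbsolutelyContinuousOnInterval f a b := by
  refine squeeze_zero' (Eventually.of_forall fun E => Finset.sum_nonneg fun i _ => dist_nonneg)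
    ?_ hg
  filter_upwards [mem_inf_of_right (mem_principal_self _)] with E hE
  exact Finset.sum_le_sum fun i hi => h _ (hE.1 i hi).1 _ (hE.1 i hi).2

variable {E : Type*} [NormedAddCommGroup E] [NormedSpace ℝ E]

theorem absolutelyContinuousOnInterval_intervalIntegral {v : ℝ → E}
    (hv : IntervalIntegrable v volume a b) :
    AbsolutelyContinuousOnInterval (fun x => ∫ t in a..x, v t) a b := by
  have hsub : ∀ x ∈ uIcc a b, IntervalIntegrable v volume a x := fun x hx =>
    hv.mono_set (uIcc_subset_uIcc_left hx)
  refine absolutelyContinuousOnInterval_of_dist_le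
    (hv.norm.absolutelyContinuousOnInterval_intervalIntegral left_mem_uIcc) fun x hx y hy => ?_
  rw [dist_eq_norm, Real.dist_eq,
    intervalIntegral.integral_interval_sub_left (hsub x hx) (hsub y hy),
    intervalIntegral.integral_interval_sub_left (hsub x hx).norm (hsub y hy).norm]
  exact intervalIntegral.norm_integral_le_abs_integral_norm

theorem eq_add_integral_deriv_of_absolutelyContinuousOnInterval [FiniteDimensional ℝ E]
    {u : ℝ → E} (hu : AbsolutelyContinuousOnInterval u a b)
    (hi : IntervalIntegrable (deriv u) volume a b) {x : ℝ} (hx : x ∈ uIcc a b) :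
    u x = u a + ∫ t in a..x, deriv u t := by
  have : CompleteSpace E := FiniteDimensional.complete ℝ E
  have hac : AbsolutelyContinuousOnInterval (fun x => u x - ∫ t in a..x, deriv u t) a b :=
    hu.sub (absolutelyContinuousOnInterval_intervalIntegral hi)
  obtain ⟨C, hC⟩ := hac.const_of_ae_hasDerivAt_zero (by
    filter_upwards [hu.boundedVariationOn.ae_differentiableAt_of_mem_uIcc,
      hi.ae_hasDerivAt_integral] with x hdiff hint hx
    simpa only [sub_self] using! (hdiff hx).hasDerivAt.sub (hint hx a left_mem_uIcc))
  have ha : u a = C := by simpa using hC a left_mem_uIcc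
  rw [ha, ← hC x hx, sub_add_cancel]

end AbsolutelyContinuous

/-- `u ∈ W^{1,2}(0, ℓ)` and `v` is a representative of `u'`. -/
structure HasW12Deriv (ℓ : ℝ) (u v : ℝ → ℂ) : Prop where
  memW12 : MemW12 ℓ u
  deriv_ae_eq : deriv u =ᵐ[μ₀ ℓ] v

section W12

variable {ℓ : ℝ} {u v u' v' : ℝ → ℂ}

theorem MemW12.hasW12Deriv (hu : MemW12 ℓ u) : HasW12Deriv ℓ u (deriv u) :=
  ⟨hu, EventuallyEq.rfl⟩

theorem intervalIntegrable_of_memLp_two (hℓ : 0 ≤ ℓ) {E : Type*} [NormedAddCommGroup E]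
    {v : ℝ → E} (hv : MemLp v 2 (μ₀ ℓ)) : IntervalIntegrable v volume 0 ℓ :=
  (intervalIntegrable_iff_integrableOn_Ioo_of_le hℓ).2 (hv.integrable one_le_two)

theorem ae_mu₀_of_ae_mem_uIcc (hℓ : 0 ≤ ℓ) {p : ℝ → Prop} (h : ∀ᵐ x, x ∈ uIcc 0 ℓ → p x) :
    ∀ᵐ x ∂μ₀ ℓ, p x := by
  rw [ae_restrict_iff' measurableSet_Ioo]
  filter_upwards [h] with x hx hx'
  exact hx (uIcc_of_le hℓ ▸ Ioo_subset_Icc_self hx')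

theorem ae_restrict_Ioc_of_ae_mu₀ {p : ℝ → Prop} {x : ℝ} (hx : x ≤ ℓ) (h : ∀ᵐ s ∂μ₀ ℓ, p s) :
    ∀ᵐ s ∂volume.restrict (Ioc 0 x), p s := by
  rw [μ₀, restrict_Ioo_eq_restrict_Ioc] at h
  exact ae_restrict_of_ae_restrict_of_subset (Ioc_subset_Ioc_right hx) h

theorem memLp_restrict_Ioc {E : Type*} [NormedAddCommGroup E] {v : ℝ → E} {x : ℝ} (hx : x ≤ ℓ)
    (hv : MemLp v 2 (μ₀ ℓ)) : MemLp v 2 (volume.restrict (Ioc 0 x)) := by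
  rw [μ₀, restrict_Ioo_eq_restrict_Ioc] at hv
  exact hv.mono_measure (Measure.restrict_mono_set _ (Ioc_subset_Ioc_right hx))

theorem intervalIntegral_congr_ae_mu₀ {E : Type*} [NormedAddCommGroup E] [NormedSpace ℝ E]
    {u v : ℝ → E} (h : u =ᵐ[μ₀ ℓ] v) {x : ℝ} (hx : x ∈ Icc 0 ℓ) :
    ∫ t in (0 : ℝ)..x, u t = ∫ t in (0 : ℝ)..x, v t := by
  rw [intervalIntegral.integral_of_le hx.1, intervalIntegral.integral_of_le hx.1]
  exact integral_congr_ae (ae_restrict_Ioc_of_ae_mu₀ hx.2 h)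

theorem memLp_top_of_continuousOn {E : Type*} [NormedAddCommGroup E] {u : ℝ → E} {a b : ℝ}
    (hu : ContinuousOn u (Icc a b)) : MemLp u ⊤ (volume.restrict (Ioo a b)) := by
  obtain ⟨C, hC⟩ := isCompact_Icc.exists_bound_of_continuousOn hu
  refine memLp_top_of_bound ((hu.mono Ioo_subset_Icc_self).aestronglyMeasurable
    measurableSet_Ioo) C ?_
  filter_upwards [ae_restrict_mem measurableSet_Ioo] with x hx
  exact hC x (Ioo_subset_Icc_self hx)

theorem memLp_two_mul_continuousOn (hv : MemLp v 2 (μ₀ ℓ)) (hu : ContinuousOn u (Icc 0 ℓ)) :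
    MemLp (fun x => v x * u x) 2 (μ₀ ℓ) :=
  MemLp.mul' (p := 2) (q := ⊤) (r := 2) (memLp_top_of_continuousOn hu) hv

theorem MemW12.continuousOn (hℓ : 0 ≤ ℓ) (hu : MemW12 ℓ u) : ContinuousOn u (Icc 0 ℓ) := by
  simpa only [uIcc_of_le hℓ] using hu.ac.continuousOn

theorem MemW12.ae_differentiableAt (hℓ : 0 ≤ ℓ) (hu : MemW12 ℓ u) :
    ∀ᵐ x ∂μ₀ ℓ, DifferentiableAt ℝ u x :=
  ae_mu₀_of_ae_mem_uIcc hℓ hu.ac.boundedVariationOn.ae_differentiableAt_of_mem_uIcc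

namespace HasW12Deriv

theorem memLp (hu : HasW12Deriv ℓ u u') : MemLp u' 2 (μ₀ ℓ) :=
  (memLp_congr_ae hu.deriv_ae_eq).1 hu.memW12.deriv_memLp

theorem congr_deriv (hu : HasW12Deriv ℓ u u') (h : u' =ᵐ[μ₀ ℓ] v') : HasW12Deriv ℓ u v' :=
  ⟨hu.memW12, hu.deriv_ae_eq.trans h⟩

theorem eq_add_integral (hℓ : 0 ≤ ℓ) (hu : HasW12Deriv ℓ u u') {x : ℝ} (hx : x ∈ Icc 0 ℓ) :
    u x = u 0 + ∫ t in (0 : ℝ)..x, u' t := by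
  rw [← intervalIntegral_congr_ae_mu₀ hu.deriv_ae_eq hx]
  exact eq_add_integral_deriv_of_absolutelyContinuousOnInterval hu.memW12.ac
    (intervalIntegrable_of_memLp_two hℓ hu.memW12.deriv_memLp) (uIcc_of_le hℓ ▸ hx)

theorem norm_le_integral (hℓ : 0 ≤ ℓ) (hu : HasW12Deriv ℓ u u') (h0 : u 0 = 0) {x : ℝ}
    (hx : x ∈ Icc 0 ℓ) : ‖u x‖ ≤ ∫ t in Ioc 0 x, ‖u' t‖ := by
  rw [hu.eq_add_integral hℓ hx, h0, zero_add, intervalIntegral.integral_of_le hx.1]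
  exact norm_integral_le_integral_norm _

theorem of_eq_add_integral (hℓ : 0 ≤ ℓ) (hv : MemLp v 2 (μ₀ ℓ)) {c : ℂ}
    (h : ∀ x ∈ Icc 0 ℓ, u x = c + ∫ t in (0 : ℝ)..x, v t) : HasW12Deriv ℓ u v := by
  have hi := intervalIntegrable_of_memLp_two hℓ hv
  have hd : deriv u =ᵐ[μ₀ ℓ] v := by
    filter_upwards [ae_mu₀_of_ae_mem_uIcc hℓ (hi.ae_hasDerivAt_integral.mono
      fun x hx hx' => hx hx' 0 left_mem_uIcc), ae_restrict_mem measurableSet_Ioo] with x hx hx'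
    refine ((hx.const_add c).congr_of_eventuallyEq ?_).deriv
    filter_upwards [Ioo_mem_nhds hx'.1 hx'.2] with y hy
    exact h y (Ioo_subset_Icc_self hy)
  refine ⟨⟨absolutelyContinuousOnInterval_of_dist_le
    (absolutelyContinuousOnInterval_intervalIntegral hi) fun x hx y hy => ?_,
    (memLp_congr_ae hd).2 hv⟩, hd⟩
  rw [uIcc_of_le hℓ] at hx hy
  rw [h x hx, h y hy, dist_add_left]

theorem add (hℓ : 0 ≤ ℓ) (hu : HasW12Deriv ℓ u u') (hv : HasW12Deriv ℓ v v') :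
    HasW12Deriv ℓ (fun x => u x + v x) fun x => u' x + v' x := by
  have hd : deriv (fun x => u x + v x) =ᵐ[μ₀ ℓ] fun x => u' x + v' x := by
    filter_upwards [hu.memW12.ae_differentiableAt hℓ, hv.memW12.ae_differentiableAt hℓ,
      hu.deriv_ae_eq, hv.deriv_ae_eq] with x hux hvx hu' hv'
    rw [← hu', ← hv']
    exact (hux.hasDerivAt.add hvx.hasDerivAt).deriv
  exact ⟨⟨hu.memW12.ac.add hv.memW12.ac, (memLp_congr_ae hd).2 (hu.memLp.add hv.memLp)⟩, hd⟩

theorem const_mul (hu : HasW12Deriv ℓ u u') (c : ℂ) :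
    HasW12Deriv ℓ (fun x => c * u x) fun x => c * u' x := by
  have hd : deriv (fun x => c * u x) =ᵐ[μ₀ ℓ] fun x => c * u' x := by
    filter_upwards [hu.deriv_ae_eq] with x hx
    rw [deriv_const_mul_field, hx]
  exact ⟨⟨hu.memW12.ac.const_smul c, (memLp_congr_ae hd).2 (hu.memLp.const_mul c)⟩, hd⟩

theorem sub (hℓ : 0 ≤ ℓ) (hu : HasW12Deriv ℓ u u') (hv : HasW12Deriv ℓ v v') :
    HasW12Deriv ℓ (fun x => u x - v x) fun x => u' x - v' x := by
  simpa only [neg_one_mul, ← sub_eq_add_neg] using hu.add hℓ (hv.const_mul (-1))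

theorem mul (hℓ : 0 ≤ ℓ) (hu : HasW12Deriv ℓ u u') (hv : HasW12Deriv ℓ v v') :
    HasW12Deriv ℓ (fun x => u x * v x) fun x => u' x * v x + u x * v' x := by
  have hd : deriv (fun x => u x * v x) =ᵐ[μ₀ ℓ] fun x => u' x * v x + u x * v' x := by
    filter_upwards [hu.memW12.ae_differentiableAt hℓ, hv.memW12.ae_differentiableAt hℓ,
      hu.deriv_ae_eq, hv.deriv_ae_eq] with x hux hvx hu' hv'
    rw [← hu', ← hv']
    exact (hux.hasDerivAt.mul hvx.hasDerivAt).deriv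
  refine ⟨⟨hu.memW12.ac.smul hv.memW12.ac, (memLp_congr_ae hd).2 ?_⟩, hd⟩
  refine (memLp_two_mul_continuousOn hu.memLp (hv.memW12.continuousOn hℓ)).add ?_
  simpa only [mul_comm] using memLp_two_mul_continuousOn hv.memLp (hu.memW12.continuousOn hℓ)

theorem integral_mul_deriv (hℓ : 0 ≤ ℓ) (hu : HasW12Deriv ℓ u u') (hv : MemW12Zero ℓ v) :
    ∫ x in (0 : ℝ)..ℓ, u x * deriv v x = -∫ x in (0 : ℝ)..ℓ, u' x * v x := by
  have hv' := hv.memW12.hasW12Deriv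
  have h := (hu.mul hℓ hv').eq_add_integral hℓ (right_mem_Icc.2 hℓ)
  rw [hv.left, hv.right, intervalIntegral.integral_add] at h
  · linear_combination -h
  · exact (intervalIntegrable_of_memLp_two hℓ hu.memLp).mul_continuousOn
      (by simpa only [uIcc_of_le hℓ] using hv.memW12.continuousOn hℓ)
  · exact (intervalIntegrable_of_memLp_two hℓ hv'.memLp).continuousOn_mul
      (by simpa only [uIcc_of_le hℓ] using hu.memW12.continuousOn hℓ)

theorem of_contDiff (hu : ContDiff ℝ 1 u) : HasW12Deriv ℓ u (deriv u) :=
  MemW12.hasW12Deriv ⟨hu.contDiffOn.absolutelyContinuousOnInterval,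
    (memLp_top_of_continuousOn (hu.continuous_deriv le_rfl).continuousOn).mono_exponent le_top⟩

end HasW12Deriv

end W12

/-! ### `L²` estimates with an exponential weight -/

section LpNorm

variable {α E F : Type*} [MeasurableSpace α] [NormedAddCommGroup E] [NormedAddCommGroup F]
  {μ ν : Measure α} {p : ENNReal} {u u' : α → E} {v : α → F}

theorem lpNorm_congr_ae (h : u =ᵐ[μ] u') : lpNorm u p μ = lpNorm u' p μ := by
  by_cases hu : AEStronglyMeasurable u μ
  · rw [← toReal_eLpNorm hu, ← toReal_eLpNorm (hu.congr h), eLpNorm_congr_ae h]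
  · rw [lpNorm_of_not_aestronglyMeasurable hu,
      lpNorm_of_not_aestronglyMeasurable fun hu' => hu (hu'.congr h.symm)]

theorem lpNorm_mono_ae (hv : MemLp v p μ) (h : ∀ᵐ x ∂μ, ‖u x‖ ≤ ‖v x‖) :
    lpNorm u p μ ≤ lpNorm v p μ := by
  by_cases hu : AEStronglyMeasurable u μ
  · rw [← toReal_eLpNorm hu, ← toReal_eLpNorm hv.1]
    exact ENNReal.toReal_mono hv.eLpNorm_ne_top (eLpNorm_mono_ae h)
  · rw [lpNorm_of_not_aestronglyMeasurable hu]
    exact lpNorm_nonneg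

theorem lpNorm_mono_measure (hu : MemLp u p ν) (h : μ ≤ ν) : lpNorm u p μ ≤ lpNorm u p ν := by
  rw [← toReal_eLpNorm hu.1, ← toReal_eLpNorm (hu.1.mono_measure h)]
  exact ENNReal.toReal_mono hu.eLpNorm_ne_top (eLpNorm_mono_measure _ h)

theorem lpNorm_indicator {s : Set α} (hs : MeasurableSet s) :
    lpNorm (s.indicator u) p μ = lpNorm u p (μ.restrict s) := by
  by_cases hu : AEStronglyMeasurable u (μ.restrict s)
  · rw [← toReal_eLpNorm hu, ← toReal_eLpNorm ((aestronglyMeasurable_indicator_iff hs).2 hu),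
      eLpNorm_indicator_eq_eLpNorm_restrict hs]
  · rw [lpNorm_of_not_aestronglyMeasurable hu,
      lpNorm_of_not_aestronglyMeasurable fun h => hu ((aestronglyMeasurable_indicator_iff hs).1 h)]

theorem lpNorm_comp_measurePreserving {β : Type*} [MeasurableSpace β] {ν : Measure β} {f : α → β}
    {g : β → E} (hg : AEStronglyMeasurable g ν) (hf : MeasurePreserving f μ ν) :
    lpNorm (fun x => g (f x)) p μ = lpNorm g p ν := by
  change lpNorm (g ∘ f) p μ = _
  rw [← toReal_eLpNorm hg, ← toReal_eLpNorm (hg.comp_measurePreserving hf)]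
  exact congrArg _ (eLpNorm_comp_measurePreserving hg hf)

theorem lpNorm_two_eq_sqrt (hu : AEStronglyMeasurable u μ) :
    lpNorm u 2 μ = √(∫ x, ‖u x‖ ^ 2 ∂μ) := by
  rw [lpNorm_eq_integral_norm_rpow_toReal two_ne_zero ENNReal.ofNat_ne_top hu, Real.sqrt_eq_rpow]
  simp

theorem integral_norm_mul_norm_le_lpNorm (hu : MemLp u 2 μ) (hv : MemLp v 2 μ) :
    ∫ x, ‖u x‖ * ‖v x‖ ∂μ ≤ lpNorm u 2 μ * lpNorm v 2 μ := by
  have h := integral_mul_norm_le_Lp_mul_Lq (μ := μ) (f := fun x => ‖u x‖) (g := fun x => ‖v x‖)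
    Real.HolderConjugate.two_two (by simpa using hu.norm) (by simpa using hv.norm)
  rw [lpNorm_two_eq_sqrt hu.1, lpNorm_two_eq_sqrt hv.1, Real.sqrt_eq_rpow, Real.sqrt_eq_rpow]
  simpa using h

theorem lpNorm_two_le_of_norm_le [IsFiniteMeasure μ] {C : ℝ} (hC : 0 ≤ C)
    (h : ∀ᵐ x ∂μ, ‖u x‖ ≤ C) : lpNorm u 2 μ ≤ C * √(μ.real univ) := by
  refine (lpNorm_mono_ae (memLp_const C) (h.mono fun x hx => hx.trans (le_abs_self C))).trans_eq ?_
  rw [lpNorm_const' two_ne_zero ENNReal.ofNat_ne_top, Real.norm_of_nonneg hC, Real.sqrt_eq_rpow]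
  simp

theorem lpNorm_const_mul {𝕜 : Type*} [NormedField 𝕜] (c : 𝕜) (f : α → 𝕜) :
    lpNorm (fun x => c * f x) p μ = ‖c‖ * lpNorm f p μ :=
  lpNorm_const_smul c f μ

end LpNorm

section Weight

variable {E : Type*} [NormedAddCommGroup E] {Λ M : ℝ}

theorem memLp_exp_mul_restrict_Ioc (c x : ℝ) :
    MemLp (fun s => Real.exp (c * s)) 2 (volume.restrict (Ioc 0 x)) := by
  rw [← restrict_Ioo_eq_restrict_Ioc]
  exact (memLp_top_of_continuousOn (by fun_prop)).mono_exponent le_top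

theorem lpNorm_exp_mul_le {c : ℝ} (hc : 0 < c) (x : ℝ) :
    lpNorm (fun s => Real.exp (c * s)) 2 (volume.restrict (Ioc 0 x)) ≤
      Real.exp (c * x) / √(2 * c) := by
  rw [lpNorm_two_eq_sqrt (by fun_prop), Real.sqrt_le_left (by positivity), div_pow,
    Real.sq_sqrt (by positivity)]
  simp only [Real.norm_eq_abs, Real.abs_exp, ← Real.exp_nat_mul, Nat.cast_ofNat]
  rcases le_or_gt x 0 with hx | hx
  · rw [Ioc_eq_empty hx.not_gt, setIntegral_empty]
    positivity
  · rw [← intervalIntegral.integral_of_le hx.le]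
    simp_rw [← mul_assoc]
    rw [intervalIntegral.integral_comp_mul_left (fun s => Real.exp s) (by positivity),
      integral_exp, mul_zero, Real.exp_zero, smul_eq_mul, inv_mul_eq_div]
    gcongr
    linarith

/-- An exponent `c` for which the Volterra operators whose coefficient has `L²` norm at most `Λ`
contract by the factor `1 / 2` in the supremum norm with weight `exp (-c x)`. -/
def rate (Λ : ℝ) : ℝ := 2 * Λ ^ 2 + 1

theorem rate_pos (Λ : ℝ) : 0 < rate Λ := by unfold rate; positivity

theorem mul_div_sqrt_rate_le (hM : 0 ≤ M) : Λ * (M / √(2 * rate Λ)) ≤ M / 2 := by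
  have hpos : 0 < √(2 * rate Λ) := Real.sqrt_pos.2 (mul_pos two_pos (rate_pos Λ))
  have hle : 2 * Λ ≤ √(2 * rate Λ) := Real.le_sqrt_of_sq_le (by unfold rate; nlinarith)
  rw [← mul_div_assoc, div_le_div_iff₀ hpos two_pos]
  nlinarith

theorem le_two_mul_of_self_improving {ι : Type*} {N w : ι → ℝ} {C M : ℝ} (hw : ∀ i, 0 < w i)
    (hN : ∀ i, 0 ≤ N i) (hC : ∀ i, N i ≤ C * w i)
    (h : ∀ B, 0 ≤ B → (∀ i, N i ≤ B * w i) → ∀ i, N i ≤ (M + B / 2) * w i) (i : ι) :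
    N i ≤ 2 * M * w i := by
  have : Nonempty ι := ⟨i⟩
  have hbdd : BddAbove (range fun i => N i / w i) :=
    ⟨C, forall_mem_range.2 fun i => (div_le_iff₀ (hw i)).2 (hC i)⟩
  set B := ⨆ i, N i / w i
  have hNB : ∀ i, N i ≤ B * w i := fun i => (div_le_iff₀ (hw i)).1 (le_ciSup hbdd i)
  have hB0 : 0 ≤ B := Real.iSup_nonneg fun i => div_nonneg (hN i) (hw i).le
  have hBM : B ≤ M + B / 2 := ciSup_le fun i => (div_le_iff₀ (hw i)).2 (h B hB0 hNB i)
  exact (hNB i).trans (mul_le_mul_of_nonneg_right (by linarith) (hw i).le)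

theorem eq_zero_of_le_integral_norm_mul {k : ℝ → E} {N : ℝ → ℝ} {ℓ : ℝ} (hk : MemLp k 2 (μ₀ ℓ))
    (hN0 : ∀ x ∈ Icc 0 ℓ, 0 ≤ N x) (hM : ∀ x ∈ Icc 0 ℓ, N x ≤ M)
    (h : ∀ x ∈ Icc 0 ℓ, N x ≤ ∫ s in Ioc 0 x, ‖k s‖ * N s) {x : ℝ} (hx : x ∈ Icc 0 ℓ) :
    N x = 0 := by
  set Λ := lpNorm k 2 (μ₀ ℓ)
  refine le_antisymm ?_ (hN0 x hx)
  suffices hx0 : N x ≤ 2 * 0 * Real.exp (rate Λ * x) by simpa using hx0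
  refine le_two_mul_of_self_improving (ι := Icc 0 ℓ) (N := fun x => N x)
    (w := fun x => Real.exp (rate Λ * x)) (C := M) (fun y => Real.exp_pos _) (fun y => hN0 y y.2)
    (fun y => ?_) (fun B hB hNB y => ?_) ⟨x, hx⟩
  · have hM0 : 0 ≤ M := (hN0 y y.2).trans (hM y y.2)
    exact (hM y y.2).trans (le_mul_of_one_le_right hM0
      (Real.one_le_exp (mul_nonneg (rate_pos _).le y.2.1)))
  have hky : MemLp k 2 (volume.restrict (Ioc 0 y.1)) := memLp_restrict_Ioc y.2.2 hk
  have hexp := memLp_exp_mul_restrict_Ioc (rate Λ) y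
  have hkΛ : lpNorm k 2 (volume.restrict (Ioc 0 y.1)) ≤ Λ :=
    lpNorm_mono_measure hk (by
      rw [μ₀, restrict_Ioo_eq_restrict_Ioc]
      exact Measure.restrict_mono_set _ (Ioc_subset_Ioc_right y.2.2))
  calc N y ≤ ∫ s in Ioc 0 y.1, ‖k s‖ * N s := h y y.2
    _ ≤ ∫ s in Ioc 0 y.1, B * (‖k s‖ * ‖Real.exp (rate Λ * s)‖) := by
        refine integral_mono_of_nonneg ?_
          ((hky.norm.integrable_mul hexp.norm).const_mul B) ?_ <;>
        filter_upwards [ae_restrict_mem measurableSet_Ioc] with s hs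
        · exact mul_nonneg (norm_nonneg _) (hN0 s ⟨hs.1.le, hs.2.trans y.2.2⟩)
        · rw [Real.norm_of_nonneg (Real.exp_pos _).le, mul_left_comm]
          exact mul_le_mul_of_nonneg_left (hNB ⟨s, hs.1.le, hs.2.trans y.2.2⟩) (norm_nonneg _)
    _ ≤ B * (lpNorm k 2 (volume.restrict (Ioc 0 y.1)) *
          lpNorm (fun s => Real.exp (rate Λ * s)) 2 (volume.restrict (Ioc 0 y.1))) := by
        rw [integral_const_mul]
        exact mul_le_mul_of_nonneg_left (integral_norm_mul_norm_le_lpNorm hky hexp) hB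
    _ ≤ B * (Λ * (Real.exp (rate Λ * y) / √(2 * rate Λ))) := by
        gcongr
        exacts [lpNorm_nonneg, lpNorm_nonneg, lpNorm_exp_mul_le (rate_pos Λ) y]
    _ ≤ B * (Real.exp (rate Λ * y) / 2) :=
        mul_le_mul_of_nonneg_left (mul_div_sqrt_rate_le (Real.exp_pos _).le) hB
    _ = (0 + B / 2) * Real.exp (rate Λ * y) := by ring

end Weight

/-! ### The Goursat problem -/

/-- A strongly measurable, square integrable function on the line, the admissible coefficients
of the first order system `y' = a y + w`, `w' = -a w - ρ² y`. -/
structure IsCoeff (a : ℝ → ℂ) : Prop where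
  meas : StronglyMeasurable a
  memLp : MemLp a 2 volume

/-- A jointly measurable kernel that vanishes outside the cone `|t| < x`. -/
structure IsConeKernel (φ : ℝ → ℝ → ℂ) : Prop where
  meas : StronglyMeasurable (Function.uncurry φ)
  eq_zero_of_le_abs : ∀ x t, x ≤ |t| → φ x t = 0

/-- A cone kernel bounded by `M` in the supremum norm with weight `exp (-c x)`. -/
structure SupBound (c M : ℝ) (φ : ℝ → ℝ → ℂ) : Prop extends IsConeKernel φ where
  norm_le : ∀ x t, ‖φ x t‖ ≤ M * Real.exp (c * x)

/-- A cone kernel whose `L²` norms on the characteristics `s ↦ (s, x - s - t)`, `0 < s ≤ x`, are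
bounded by `M` with weight `exp (-c x)`. -/
structure CharBound (c M : ℝ) (φ : ℝ → ℝ → ℂ) : Prop extends IsConeKernel φ where
  memLp : ∀ x t, MemLp (fun s => φ s (x - s - t)) 2 (volume.restrict (Ioc 0 x))
  lpNorm_le : ∀ x t, lpNorm (fun s => φ s (x - s - t)) 2 (volume.restrict (Ioc 0 x)) ≤
    M * Real.exp (c * x)

/-- The operator `φ ↦ ∫₀ˣ a(s) φ(s, x - s - t) ds`, the iteration step of the Goursat problem. -/
def volterra (a : ℝ → ℂ) (φ : ℝ → ℝ → ℂ) (x t : ℝ) : ℂ :=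
  ∫ s in Ioc 0 x, a s * φ s (x - s - t)

/-- The free term of the Goursat problem. -/
def seed (a : ℝ → ℂ) (x t : ℝ) : ℂ := if |t| < x then a ((x - t) / 2) / 2 else 0

/-- The solution `S = seed a + volterra a S` of the Goursat problem, as a Neumann series. -/
def goursat (a : ℝ → ℂ) (x t : ℝ) : ℂ := ∑' n, (volterra a)^[n] (seed a) x t

section Goursat

variable {a a' : ℝ → ℂ} {φ ψ : ℝ → ℝ → ℂ} {c M N Λ : ℝ}

namespace IsCoeff

theorem neg (ha : IsCoeff a) : IsCoeff (-a) := ⟨ha.meas.neg, ha.memLp.neg⟩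

theorem sub (ha : IsCoeff a) (ha' : IsCoeff a') : IsCoeff (a - a') :=
  ⟨ha.meas.sub ha'.meas, ha.memLp.sub ha'.memLp⟩

end IsCoeff

namespace IsConeKernel

theorem add (hφ : IsConeKernel φ) (hψ : IsConeKernel ψ) : IsConeKernel (φ + ψ) :=
  ⟨hφ.meas.add hψ.meas, fun x t h => by
    simp only [Pi.add_apply, hφ.eq_zero_of_le_abs x t h, hψ.eq_zero_of_le_abs x t h, add_zero]⟩

theorem sub (hφ : IsConeKernel φ) (hψ : IsConeKernel ψ) : IsConeKernel (φ - ψ) :=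
  ⟨hφ.meas.sub hψ.meas, fun x t h => by
    simp only [Pi.sub_apply, hφ.eq_zero_of_le_abs x t h, hψ.eq_zero_of_le_abs x t h, sub_zero]⟩

theorem stronglyMeasurable_char (hφ : IsConeKernel φ) (x t : ℝ) :
    StronglyMeasurable fun s => φ s (x - s - t) :=
  hφ.meas.comp_measurable (show Measurable fun s : ℝ => (s, x - s - t) by fun_prop)

theorem stronglyMeasurable_volterra (ha : StronglyMeasurable a) (hφ : IsConeKernel φ) :
    StronglyMeasurable (Function.uncurry (volterra a φ)) := by
  have h : Function.uncurry (volterra a φ) = fun p : ℝ × ℝ =>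
      ∫ s, {q : (ℝ × ℝ) × ℝ | 0 < q.2 ∧ q.2 ≤ q.1.1}.indicator
        (fun q => a q.2 * Function.uncurry φ (q.2, q.1.1 - q.2 - q.1.2)) (p, s) := by
    funext ⟨x, t⟩
    simp only [Function.uncurry, volterra]
    rw [← integral_indicator measurableSet_Ioc]
    rfl
  rw [h]
  refine StronglyMeasurable.integral_prod_right ?_
  refine StronglyMeasurable.indicator ?_ ?_
  · exact (ha.comp_measurable measurable_snd).mul (hφ.meas.comp_measurable (by fun_prop))
  · exact (measurableSet_lt measurable_const measurable_snd).inter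
      (measurableSet_le measurable_snd (by fun_prop))

theorem volterra (ha : StronglyMeasurable a) (hφ : IsConeKernel φ) :
    IsConeKernel (volterra a φ) := by
  refine ⟨hφ.stronglyMeasurable_volterra ha, fun x t h => ?_⟩
  refine setIntegral_eq_zero_of_forall_eq_zero fun s hs => ?_
  rw [hφ.eq_zero_of_le_abs s _, mul_zero]
  by_contra! hlt
  rw [abs_lt] at hlt
  rcases le_abs.1 h with h | h <;> linarith [hs.1, hs.2]

end IsConeKernel

theorem isConeKernel_seed (ha : StronglyMeasurable a) : IsConeKernel (seed a) := by
  refine ⟨?_, fun x t h => if_neg h.not_gt⟩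
  refine StronglyMeasurable.ite (measurableSet_lt (by fun_prop) (by fun_prop)) ?_
    stronglyMeasurable_const
  simp only [div_eq_mul_inv _ (2 : ℂ)]
  exact (ha.comp_measurable
    (show Measurable fun p : ℝ × ℝ => (p.1 - p.2) / 2 by fun_prop)).mul_const _

theorem seed_sub (a a' : ℝ → ℂ) : seed (a - a') = seed a - seed a' := by
  ext x t
  simp only [seed, Pi.sub_apply]
  split_ifs <;> ring

theorem SupBound.charBound (hc : 0 < c) (hM : 0 ≤ M) (hφ : SupBound c M φ) :
    CharBound c (M / √(2 * c)) φ := by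
  have hexp (x : ℝ) := (memLp_exp_mul_restrict_Ioc c x).const_mul M
  have hle (x t : ℝ) : ∀ᵐ s ∂volume.restrict (Ioc 0 x),
      ‖φ s (x - s - t)‖ ≤ ‖M * Real.exp (c * s)‖ :=
    ae_of_all _ fun s => (hφ.norm_le s _).trans (le_abs_self _)
  refine ⟨hφ.toIsConeKernel, fun x t => (hexp x).mono
    (hφ.stronglyMeasurable_char x t).aestronglyMeasurable (hle x t), fun x t => ?_⟩
  calc lpNorm (fun s => φ s (x - s - t)) 2 (volume.restrict (Ioc 0 x))
      ≤ lpNorm (fun s => M * Real.exp (c * s)) 2 (volume.restrict (Ioc 0 x)) :=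
        lpNorm_mono_ae (hexp x) (hle x t)
    _ = M * lpNorm (fun s => Real.exp (c * s)) 2 (volume.restrict (Ioc 0 x)) := by
        rw [lpNorm_const_mul, Real.norm_of_nonneg hM]
    _ ≤ M * (Real.exp (c * x) / √(2 * c)) :=
        mul_le_mul_of_nonneg_left (lpNorm_exp_mul_le hc x) hM
    _ = M / √(2 * c) * Real.exp (c * x) := by ring

namespace CharBound

theorem mono (hMN : M ≤ N) (hφ : CharBound c M φ) : CharBound c N φ :=
  ⟨hφ.toIsConeKernel, hφ.memLp, fun x t => (hφ.lpNorm_le x t).trans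
    (mul_le_mul_of_nonneg_right hMN (Real.exp_pos _).le)⟩

theorem add (hφ : CharBound c M φ) (hψ : CharBound c N ψ) : CharBound c (M + N) (φ + ψ) := by
  refine ⟨hφ.toIsConeKernel.add hψ.toIsConeKernel, fun x t => (hφ.memLp x t).add (hψ.memLp x t),
    fun x t => ?_⟩
  rw [add_mul]
  exact (lpNorm_add_le (hφ.memLp x t) one_le_two).trans
    (add_le_add (hφ.lpNorm_le x t) (hψ.lpNorm_le x t))

theorem integrableOn_mul (ha : IsCoeff a) (hφ : CharBound c M φ) (x t : ℝ) :
    IntegrableOn (fun s => a s * φ s (x - s - t)) (Ioc 0 x) :=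
  (ha.memLp.restrict _).integrable_mul (hφ.memLp x t)

theorem integral_norm_mul_le (ha : IsCoeff a) (hφ : CharBound c M φ) (x t : ℝ) :
    ∫ s in Ioc 0 x, ‖a s * φ s (x - s - t)‖ ≤ lpNorm a 2 volume * M * Real.exp (c * x) := by
  simp only [norm_mul]
  rw [mul_assoc]
  exact (integral_norm_mul_norm_le_lpNorm (ha.memLp.restrict _) (hφ.memLp x t)).trans
    (mul_le_mul (lpNorm_mono_measure ha.memLp Measure.restrict_le_self) (hφ.lpNorm_le x t)
      lpNorm_nonneg lpNorm_nonneg)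

theorem supBound_volterra (ha : IsCoeff a) (hφ : CharBound c M φ) :
    SupBound c (lpNorm a 2 volume * M) (volterra a φ) :=
  ⟨hφ.toIsConeKernel.volterra ha.meas, fun x t =>
    (norm_integral_le_integral_norm _).trans (hφ.integral_norm_mul_le ha x t)⟩

theorem nonneg (hφ : CharBound c M φ) : 0 ≤ M :=
  nonneg_of_mul_nonneg_left (lpNorm_nonneg.trans (hφ.lpNorm_le 0 0)) (Real.exp_pos _)

theorem volterra_sub_left (ha : IsCoeff a) (ha' : IsCoeff a') (hφ : CharBound c M φ) :
    volterra (a - a') φ = volterra a φ - volterra a' φ := by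
  ext x t
  simp only [volterra, Pi.sub_apply, sub_mul]
  exact integral_sub (hφ.integrableOn_mul ha x t) (hφ.integrableOn_mul ha' x t)

theorem volterra_sub_right (ha : IsCoeff a) (hφ : CharBound c M φ) (hψ : CharBound c N ψ) :
    volterra a (φ - ψ) = volterra a φ - volterra a ψ := by
  ext x t
  simp only [volterra, Pi.sub_apply, mul_sub]
  exact integral_sub (hφ.integrableOn_mul ha x t) (hψ.integrableOn_mul ha x t)

end CharBound

theorem charBound_seed (hc : 0 ≤ c) (ha : IsCoeff a) :
    CharBound c (lpNorm a 2 volume / 2) (seed a) := by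
  have hmp (y : ℝ) := measurePreserving_sub_right (volume : Measure ℝ) y
  have hmem (y : ℝ) : MemLp (fun s => 2⁻¹ * a (s - y)) 2 volume :=
    (ha.memLp.comp_measurePreserving (hmp y)).const_mul 2⁻¹
  have hnorm (y : ℝ) : lpNorm (fun s => 2⁻¹ * a (s - y)) 2 volume = lpNorm a 2 volume / 2 := by
    rw [lpNorm_const_mul, lpNorm_comp_measurePreserving ha.memLp.1 (hmp y), norm_inv,
      Complex.norm_ofNat, inv_mul_eq_div]
  have hle (s x t : ℝ) : ‖seed a s (x - s - t)‖ ≤ ‖2⁻¹ * a (s - (x - t) / 2)‖ := by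
    unfold seed
    split_ifs
    · rw [show (s - (x - s - t)) / 2 = s - (x - t) / 2 by ring, div_eq_inv_mul]
    · exact norm_zero.trans_le (norm_nonneg _)
  refine ⟨isConeKernel_seed ha.meas, fun x t => ((hmem ((x - t) / 2)).restrict _).mono
    ((isConeKernel_seed ha.meas).stronglyMeasurable_char x t).aestronglyMeasurable
    (ae_of_all _ fun s => hle s x t), fun x t => ?_⟩
  rcases le_or_gt x 0 with hx | hx
  · rw [Ioc_eq_empty hx.not_gt, Measure.restrict_empty, lpNorm_measure_zero]
    exact mul_nonneg (div_nonneg lpNorm_nonneg zero_le_two) (Real.exp_pos _).le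
  · calc lpNorm (fun s => seed a s (x - s - t)) 2 (volume.restrict (Ioc 0 x))
        ≤ lpNorm (fun s => 2⁻¹ * a (s - (x - t) / 2)) 2 (volume.restrict (Ioc 0 x)) :=
          lpNorm_mono_ae ((hmem _).restrict _) (ae_of_all _ fun s => hle s x t)
      _ ≤ lpNorm (fun s => 2⁻¹ * a (s - (x - t) / 2)) 2 volume :=
          lpNorm_mono_measure (hmem _) Measure.restrict_le_self
      _ ≤ lpNorm a 2 volume / 2 * Real.exp (c * x) := by
          rw [hnorm]
          exact le_mul_of_one_le_right (div_nonneg lpNorm_nonneg zero_le_two)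
            (Real.one_le_exp (mul_nonneg hc hx.le))

theorem charBound_iterate_volterra_seed (ha : IsCoeff a) (hΛ : lpNorm a 2 volume ≤ Λ) (n : ℕ) :
    CharBound (rate Λ) (Λ / 2 / 2 ^ n) ((volterra a)^[n] (seed a)) := by
  have hΛ0 : 0 ≤ Λ := lpNorm_nonneg.trans hΛ
  induction n with
  | zero => exact (charBound_seed (rate_pos Λ).le ha).mono (by rw [pow_zero, div_one]; gcongr)
  | succ n ih =>
    rw [Function.iterate_succ_apply']
    refine ((ih.supBound_volterra ha).charBound (rate_pos Λ)
      (mul_nonneg lpNorm_nonneg ih.nonneg)).mono ?_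
    calc lpNorm a 2 volume * (Λ / 2 / 2 ^ n) / √(2 * rate Λ)
        ≤ Λ * ((Λ / 2 / 2 ^ n) / √(2 * rate Λ)) := by
          rw [mul_div_assoc]
          exact mul_le_mul_of_nonneg_right hΛ (by positivity)
      _ ≤ Λ / 2 / 2 ^ n / 2 := mul_div_sqrt_rate_le ih.nonneg
      _ = Λ / 2 / 2 ^ (n + 1) := by rw [pow_succ]; ring

theorem norm_iterate_succ_volterra_seed_le (ha : IsCoeff a) (hΛ : lpNorm a 2 volume ≤ Λ) (n : ℕ)
    (x t : ℝ) : ‖(volterra a)^[n + 1] (seed a) x t‖ ≤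
      Λ ^ 2 / 2 / 2 ^ n * Real.exp (rate Λ * x) := by
  have h := charBound_iterate_volterra_seed ha hΛ n
  rw [Function.iterate_succ_apply']
  refine ((h.supBound_volterra ha).norm_le x t).trans ?_
  rw [show Λ ^ 2 / 2 / 2 ^ n = Λ * (Λ / 2 / 2 ^ n) by ring]
  gcongr
  exact h.nonneg

theorem summable_iterate_volterra_seed (ha : IsCoeff a) (x t : ℝ) :
    Summable fun n => (volterra a)^[n] (seed a) x t :=
  (summable_nat_add_iff 1).1 <| Summable.of_norm_bounded
    ((hasSum_geometric_two' _).mul_right _).summable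
    fun n => norm_iterate_succ_volterra_seed_le ha le_rfl n x t

theorem supBound_goursat_sub_seed (ha : IsCoeff a) (hΛ : lpNorm a 2 volume ≤ Λ) :
    SupBound (rate Λ) (Λ ^ 2) (goursat a - seed a) := by
  have hcone (n : ℕ) := (charBound_iterate_volterra_seed ha hΛ n).toIsConeKernel
  have hsplit (x t : ℝ) : (goursat a - seed a) x t = ∑' n, (volterra a)^[n + 1] (seed a) x t := by
    simp only [goursat, Pi.sub_apply, (summable_iterate_volterra_seed ha x t).tsum_eq_zero_add,
      Function.iterate_zero, id_eq, add_sub_cancel_left]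
  have hmeas : StronglyMeasurable (Function.uncurry (goursat a)) := by
    refine stronglyMeasurable_of_tendsto (f := fun n (p : ℝ × ℝ) =>
      ∑ i ∈ Finset.range n, (volterra a)^[i] (seed a) p.1 p.2) atTop
      (fun n => Finset.stronglyMeasurable_fun_sum _ fun i _ => (hcone i).meas) ?_
    exact tendsto_pi_nhds.2 fun p =>
      (summable_iterate_volterra_seed ha p.1 p.2).hasSum.tendsto_sum_nat
  refine ⟨⟨hmeas.sub (isConeKernel_seed ha.meas).meas, fun x t h => ?_⟩, fun x t => ?_⟩
  · rw [hsplit]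
    simp only [(hcone _).eq_zero_of_le_abs x t h, tsum_zero]
  · rw [hsplit]
    exact tsum_of_norm_bounded ((hasSum_geometric_two' _).mul_right _)
      fun n => norm_iterate_succ_volterra_seed_le ha hΛ n x t

theorem charBound_goursat (ha : IsCoeff a) (hΛ : lpNorm a 2 volume ≤ Λ) :
    CharBound (rate Λ) Λ (goursat a) := by
  have h := (charBound_seed (rate_pos Λ).le ha).add
    ((supBound_goursat_sub_seed ha hΛ).charBound (rate_pos Λ) (sq_nonneg Λ))
  rw [add_sub_cancel] at h
  refine h.mono ?_
  have hΛ0 : 0 ≤ Λ := lpNorm_nonneg.trans hΛ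
  have := mul_div_sqrt_rate_le (Λ := Λ) hΛ0
  rw [← mul_div_assoc, ← sq] at this
  linarith

theorem goursat_eq_seed_add_volterra (ha : IsCoeff a) :
    goursat a = seed a + volterra a (goursat a) := by
  ext x t
  have hn (n : ℕ) := charBound_iterate_volterra_seed ha le_rfl n
  have hsum : HasSum (fun n => (volterra a)^[n + 1] (seed a) x t) (volterra a (goursat a) x t) := by
    simp only [Function.iterate_succ_apply', volterra, goursat, ← tsum_mul_left]
    refine hasSum_integral_of_summable_integral_norm (fun n => (hn n).integrableOn_mul ha x t) ?_
    refine Summable.of_nonneg_of_le (fun n => integral_nonneg fun s => norm_nonneg _)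
      (fun n => (hn n).integral_norm_mul_le ha x t) ?_
    exact (((hasSum_geometric_two' _).mul_left _).mul_right _).summable
  rw [goursat, (summable_iterate_volterra_seed ha x t).tsum_eq_zero_add, hsum.tsum_eq]
  rfl

theorem goursat_sub_seed_sub_eq (ha : IsCoeff a) (ha' : IsCoeff a') :
    goursat a - seed a - (goursat a' - seed a') =
      volterra (a - a') (goursat a') +
        volterra a (seed (a - a') + (goursat a - seed a - (goursat a' - seed a'))) := by
  have hS := charBound_goursat ha (le_max_left _ (lpNorm a' 2 volume))
  have hS' := charBound_goursat ha' (le_max_right (lpNorm a 2 volume) _)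
  have hsub : seed (a - a') + (goursat a - seed a - (goursat a' - seed a')) =
      goursat a - goursat a' := by
    rw [seed_sub]
    abel
  rw [hsub, hS'.volterra_sub_left ha ha', hS.volterra_sub_right ha hS',
    sub_eq_of_eq_add' (goursat_eq_seed_add_volterra ha),
    sub_eq_of_eq_add' (goursat_eq_seed_add_volterra ha')]
  abel

theorem norm_goursat_sub_seed_sub_le (ha : IsCoeff a) (ha' : IsCoeff a')
    (hΛ : lpNorm a 2 volume ≤ Λ) (hΛ' : lpNorm a' 2 volume ≤ Λ) (x t : ℝ) :
    ‖(goursat a - seed a - (goursat a' - seed a')) x t‖ ≤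
      3 * Λ * lpNorm (a - a') 2 volume * Real.exp (rate Λ * x) := by
  set d := lpNorm (a - a') 2 volume
  set D := goursat a - seed a - (goursat a' - seed a')
  have hS' := charBound_goursat ha' hΛ'
  have hcone : IsConeKernel D := (supBound_goursat_sub_seed ha hΛ).toIsConeKernel.sub
    (supBound_goursat_sub_seed ha' hΛ').toIsConeKernel
  have hDeq : D = volterra (a - a') (goursat a') + volterra a (seed (a - a') + D) :=
    goursat_sub_seed_sub_eq ha ha'
  have hself : ∀ B, 0 ≤ B → (∀ p : ℝ × ℝ, ‖D p.1 p.2‖ ≤ B * Real.exp (rate Λ * p.1)) →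
      ∀ p : ℝ × ℝ, ‖D p.1 p.2‖ ≤ (3 / 2 * Λ * d + B / 2) * Real.exp (rate Λ * p.1) := by
    intro B hB hDB p
    have hbound : SupBound (rate Λ) B D := ⟨hcone, fun x t => hDB (x, t)⟩
    have hsum := (charBound_seed (rate_pos Λ).le (ha.sub ha')).add
      (hbound.charBound (rate_pos Λ) hB)
    have hΛsum : lpNorm a 2 volume * (d / 2 + B / √(2 * rate Λ)) ≤ Λ * d / 2 + B / 2 := by
      refine (mul_le_mul_of_nonneg_right hΛ hsum.nonneg).trans ?_
      linarith [mul_div_sqrt_rate_le (Λ := Λ) hB]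
    rw [hDeq]
    calc ‖(volterra (a - a') (goursat a') + volterra a (seed (a - a') + D)) p.1 p.2‖
        ≤ d * Λ * Real.exp (rate Λ * p.1) +
          lpNorm a 2 volume * (d / 2 + B / √(2 * rate Λ)) * Real.exp (rate Λ * p.1) :=
          (norm_add_le _ _).trans (add_le_add
            ((hS'.supBound_volterra (ha.sub ha')).norm_le p.1 p.2)
            ((hsum.supBound_volterra ha).norm_le p.1 p.2))
      _ ≤ (3 / 2 * Λ * d + B / 2) * Real.exp (rate Λ * p.1) := by
          rw [← add_mul]
          exact mul_le_mul_of_nonneg_right (by linarith) (Real.exp_pos _).le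
  refine (le_two_mul_of_self_improving (N := fun p : ℝ × ℝ => ‖D p.1 p.2‖)
    (w := fun p => Real.exp (rate Λ * p.1)) (C := Λ ^ 2 + Λ ^ 2) (fun p => Real.exp_pos _)
    (fun p => norm_nonneg _) (fun p => ?_) hself (x, t)).trans_eq (by ring)
  rw [add_mul]
  exact (norm_sub_le _ _).trans (add_le_add ((supBound_goursat_sub_seed ha hΛ).norm_le p.1 p.2)
    ((supBound_goursat_sub_seed ha' hΛ').norm_le p.1 p.2))

end Goursat

/-! ### Slices of kernels and their integral operators -/

/-- The slices `K x` belong to `L²(-x, x)`, `0 < x ≤ ℓ`, with norms at most `C`. -/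
def SliceBound (ℓ C : ℝ) (K : ℝ → ℝ → ℂ) : Prop :=
  ∀ x ∈ Ioc 0 ℓ, MemLp (K x) 2 (μ₁ x) ∧ lpNorm (K x) 2 (μ₁ x) ≤ C

/-- The integral operator `u ↦ ∫_{-x}^{x} K(x, t) u(t) dt`. -/
def integralOp (K : ℝ → ℝ → ℂ) (u : ℝ → ℂ) (x : ℝ) : ℂ := ∫ t in Ioo (-x) x, K x t * u t

/-- The even part of `φ x` plus the odd part of `ψ x`. -/
def evenAddOdd (φ ψ : ℝ → ℝ → ℂ) (x t : ℝ) : ℂ :=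
  2⁻¹ * (φ x t + φ x (-t)) + 2⁻¹ * (ψ x t - ψ x (-t))

section Slice

variable {a : ℝ → ℂ} {φ ψ K K' : ℝ → ℝ → ℂ} {u : ℝ → ℂ} {x ℓ c C C' M : ℝ}

theorem μ₁_mono (hx : x ≤ ℓ) : μ₁ x ≤ μ₁ ℓ :=
  Measure.restrict_mono_set _ (Ioo_subset_Ioo (neg_le_neg hx) hx)

theorem measureReal_μ₁_univ (hx : 0 ≤ x) : (μ₁ x).real univ = 2 * x := by
  rw [measureReal_restrict_apply_univ, Real.volume_real_Ioo_of_le (by linarith)]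
  ring

theorem measurePreserving_neg_μ₁ (x : ℝ) : MeasurePreserving (fun t => -t) (μ₁ x) (μ₁ x) := by
  have h := (Measure.measurePreserving_neg (volume : Measure ℝ)).restrict_preimage
    (measurableSet_Ioo (a := -x) (b := x))
  rwa [neg_preimage, neg_Ioo, neg_neg] at h

theorem stronglyMeasurable_integralOp (hK : StronglyMeasurable (Function.uncurry K))
    (hu : StronglyMeasurable u) : StronglyMeasurable (integralOp K u) := by
  have h : integralOp K u = fun x => ∫ t, {p : ℝ × ℝ | -p.1 < p.2 ∧ p.2 < p.1}.indicator
      (fun p => Function.uncurry K p * u p.2) (x, t) := by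
    funext x
    rw [integralOp, ← integral_indicator measurableSet_Ioo]
    rfl
  rw [h]
  refine StronglyMeasurable.integral_prod_right' (StronglyMeasurable.indicator ?_ ?_)
  · exact hK.mul (hu.comp_measurable measurable_snd)
  · exact (measurableSet_lt measurable_fst.neg measurable_snd).inter
      (measurableSet_lt measurable_snd measurable_fst)

namespace SliceBound

theorem memLp (hK : SliceBound x C K) : MemLp (K x) 2 (μ₁ x) := by
  rcases le_or_gt x 0 with hx | hx
  · rw [μ₁, Ioo_eq_empty (by linarith), Measure.restrict_empty]
    exact memLp_measure_zero
  · exact (hK x (right_mem_Ioc.2 hx)).1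

theorem add (hK : SliceBound ℓ C K) (hK' : SliceBound ℓ C' K') :
    SliceBound ℓ (C + C') (K + K') := fun x hx =>
  ⟨(hK x hx).1.add (hK' x hx).1, (lpNorm_add_le (hK x hx).1 one_le_two).trans
    (add_le_add (hK x hx).2 (hK' x hx).2)⟩

theorem evenAddOdd (hφ : SliceBound ℓ C φ) (hψ : SliceBound ℓ C' ψ) :
    SliceBound ℓ (C + C') (evenAddOdd φ ψ) := by
  have hpart {b : ℝ} {v : ℝ → ℂ} {x : ℝ} (hv : MemLp v 2 (μ₁ x)) (hb : lpNorm v 2 (μ₁ x) ≤ b) :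
      (MemLp (fun t => 2⁻¹ * (v t + v (-t))) 2 (μ₁ x) ∧
        lpNorm (fun t => 2⁻¹ * (v t + v (-t))) 2 (μ₁ x) ≤ b) ∧
      (MemLp (fun t => 2⁻¹ * (v t - v (-t))) 2 (μ₁ x) ∧
        lpNorm (fun t => 2⁻¹ * (v t - v (-t))) 2 (μ₁ x) ≤ b) := by
    have hneg := hv.comp_measurePreserving (measurePreserving_neg_μ₁ x)
    have hnorm := lpNorm_comp_measurePreserving (p := 2) hv.1 (measurePreserving_neg_μ₁ x)
    have hadd := lpNorm_add_le hv one_le_two (g := fun t => v (-t))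
    have hsub := lpNorm_sub_le hv one_le_two (g := fun t => v (-t))
    rw [hnorm] at hadd hsub
    refine ⟨⟨(hv.add hneg).const_mul _, ?_⟩, (hv.sub hneg).const_mul _, ?_⟩ <;>
    rw [lpNorm_const_mul, norm_inv, Complex.norm_ofNat, inv_mul_le_iff₀ two_pos]
    · exact hadd.trans (by linarith)
    · exact hsub.trans (by linarith)
  intro x hx
  obtain ⟨heven, -⟩ := hpart (hφ x hx).1 (hφ x hx).2
  obtain ⟨-, hodd⟩ := hpart (hψ x hx).1 (hψ x hx).2
  exact ⟨heven.1.add hodd.1,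
    (lpNorm_add_le heven.1 one_le_two).trans (add_le_add heven.2 hodd.2)⟩

theorem nonneg (hℓ : 0 < ℓ) (hK : SliceBound ℓ C K) : 0 ≤ C :=
  lpNorm_nonneg.trans (hK ℓ (right_mem_Ioc.2 hℓ)).2

theorem norm_integralOp_le (hℓ : 0 < ℓ) (hK : SliceBound ℓ C K) (hx : x ≤ ℓ)
    (hu : MemLp u 2 (μ₁ ℓ)) : ‖integralOp K u x‖ ≤ C * lpNorm u 2 (μ₁ ℓ) := by
  rcases le_or_gt x 0 with hx0 | hx0
  · rw [integralOp, Ioo_eq_empty (by linarith), setIntegral_empty, norm_zero]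
    exact mul_nonneg (hK.nonneg hℓ) lpNorm_nonneg
  have hKx := hK x ⟨hx0, hx⟩
  refine (norm_integral_le_integral_norm _).trans ?_
  simp only [norm_mul]
  exact (integral_norm_mul_norm_le_lpNorm hKx.1 (hu.mono_measure (μ₁_mono hx))).trans
    (mul_le_mul hKx.2 (lpNorm_mono_measure hu (μ₁_mono hx)) lpNorm_nonneg (hK.nonneg hℓ))

theorem memLp_top_integralOp (hK : SliceBound ℓ C K)
    (hmeas : StronglyMeasurable (Function.uncurry K)) (hu : StronglyMeasurable u)
    (hu2 : MemLp u 2 (μ₁ ℓ)) : MemLp (integralOp K u) ⊤ (μ₀ ℓ) := by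
  refine memLp_top_of_bound (stronglyMeasurable_integralOp hmeas hu).aestronglyMeasurable
    (C * lpNorm u 2 (μ₁ ℓ)) ?_
  filter_upwards [ae_restrict_mem measurableSet_Ioo] with x hx
  exact hK.norm_integralOp_le (hx.1.trans hx.2) hx.2.le hu2

end SliceBound

theorem SupBound.sliceBound (hc : 0 ≤ c) (hM : 0 ≤ M) (hφ : SupBound c M φ) :
    SliceBound ℓ (M * Real.exp (c * ℓ) * √(2 * ℓ)) φ := by
  intro x hx
  have hmeas : StronglyMeasurable (φ x) := hφ.meas.comp_measurable measurable_prodMk_left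
  have hle (t : ℝ) : ‖φ x t‖ ≤ M * Real.exp (c * ℓ) := by
    refine (hφ.norm_le x t).trans ?_
    gcongr
    exact hx.2
  refine ⟨(memLp_top_of_bound hmeas.aestronglyMeasurable _ (ae_of_all _ hle)).mono_exponent le_top,
    (lpNorm_two_le_of_norm_le (by positivity) (ae_of_all _ hle)).trans ?_⟩
  rw [measureReal_μ₁_univ hx.1.le]
  gcongr
  exact hx.2

theorem sliceBound_seed (ha : IsCoeff a) : SliceBound ℓ (lpNorm a 2 volume) (seed a) := by
  intro x _
  have hmeas : StronglyMeasurable fun t => a ((x - t) / 2) :=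
    ha.meas.comp_measurable (by fun_prop)
  have hmem : MemLp (fun t => a ((x - t) / 2)) 2 volume :=
    (memLp_two_iff_integrable_sq_norm hmeas.aestronglyMeasurable).2 <|
      (((memLp_two_iff_integrable_sq_norm ha.memLp.1).1 ha.memLp).comp_div
        two_ne_zero).comp_sub_left x
  have hnorm : lpNorm (fun t => a ((x - t) / 2)) 2 volume = √2 * lpNorm a 2 volume := by
    rw [lpNorm_two_eq_sqrt hmem.1, lpNorm_two_eq_sqrt ha.memLp.1,
      integral_sub_left_eq_self (fun t => ‖a (t / 2)‖ ^ 2) volume x,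
      Measure.integral_comp_div (fun t => ‖a t‖ ^ 2) 2, smul_eq_mul, abs_two,
      Real.sqrt_mul zero_le_two]
  have hle (t : ℝ) : ‖seed a x t‖ ≤ ‖2⁻¹ * a ((x - t) / 2)‖ := by
    unfold seed
    split_ifs
    · rw [div_eq_inv_mul]
    · exact norm_zero.trans_le (norm_nonneg _)
  have hmem' := hmem.const_mul 2⁻¹
  have hseed : MemLp (seed a x) 2 volume := hmem'.mono
    ((isConeKernel_seed ha.meas).meas.comp_measurable measurable_prodMk_left).aestronglyMeasurable
    (ae_of_all _ hle)
  refine ⟨hseed.restrict _, (lpNorm_mono_measure hseed Measure.restrict_le_self).trans ?_⟩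
  refine (lpNorm_mono_ae hmem' (ae_of_all _ hle)).trans ?_
  rw [lpNorm_const_mul, hnorm, norm_inv, Complex.norm_ofNat, ← mul_assoc]
  refine mul_le_of_le_one_left lpNorm_nonneg ?_
  rw [inv_mul_le_one₀ two_pos]
  exact Real.sqrt_le_iff.2 ⟨zero_le_two, by norm_num⟩

theorem IsConeKernel.evenAddOdd (hφ : IsConeKernel φ) (hψ : IsConeKernel ψ) :
    IsConeKernel (evenAddOdd φ ψ) := by
  have hneg : Measurable fun p : ℝ × ℝ => (p.1, -p.2) := by fun_prop
  refine ⟨((hφ.meas.add (hφ.meas.comp_measurable hneg)).const_mul _).add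
    ((hψ.meas.sub (hψ.meas.comp_measurable hneg)).const_mul _), fun x t h => ?_⟩
  have h' : x ≤ |-t| := by rwa [abs_neg]
  simp only [Transmutation.evenAddOdd, hφ.eq_zero_of_le_abs x _ h, hφ.eq_zero_of_le_abs x _ h',
    hψ.eq_zero_of_le_abs x _ h, hψ.eq_zero_of_le_abs x _ h', add_zero, sub_zero, mul_zero]

theorem integralOp_add (hφ : MemLp (φ x) 2 (μ₁ x)) (hψ : MemLp (ψ x) 2 (μ₁ x))
    (hu : MemLp u 2 (μ₁ x)) :
    integralOp (φ + ψ) u x = integralOp φ u x + integralOp ψ u x := by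
  simp only [integralOp, Pi.add_apply, add_mul]
  exact integral_add (hφ.integrable_mul hu) (hψ.integrable_mul hu)

theorem integralOp_sub (hφ : MemLp (φ x) 2 (μ₁ x)) (hψ : MemLp (ψ x) 2 (μ₁ x))
    (hu : MemLp u 2 (μ₁ x)) :
    integralOp (φ - ψ) u x = integralOp φ u x - integralOp ψ u x := by
  simp only [integralOp, Pi.sub_apply, sub_mul]
  exact integral_sub (hφ.integrable_mul hu) (hψ.integrable_mul hu)

theorem integralOp_evenAddOdd (hφ : MemLp (φ x) 2 (μ₁ x)) (hψ : MemLp (ψ x) 2 (μ₁ x))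
    (hu : MemLp u 2 (μ₁ x)) :
    integralOp (evenAddOdd φ ψ) u x =
      2⁻¹ * (integralOp φ u x + integralOp φ (fun t => u (-t)) x) +
        2⁻¹ * (integralOp ψ u x - integralOp ψ (fun t => u (-t)) x) := by
  have hmp := measurePreserving_neg_μ₁ x
  have hreflect {v : ℝ → ℂ} (hv : MemLp v 2 (μ₁ x)) :
      Integrable (fun t => v (-t) * u t) (μ₁ x) ∧
        ∫ t, v t * u (-t) ∂μ₁ x = ∫ t, v (-t) * u t ∂μ₁ x := by
    refine ⟨(hv.comp_measurePreserving hmp).integrable_mul hu, ?_⟩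
    simpa only [neg_neg] using
      (hmp.integral_comp (Homeomorph.neg ℝ).measurableEmbedding fun t => v (-t) * u t)
  obtain ⟨hφ', hφeq⟩ := hreflect hφ
  obtain ⟨hψ', hψeq⟩ := hreflect hψ
  have hφu : Integrable (fun t => φ x t * u t) (μ₁ x) := hφ.integrable_mul hu
  have hψu : Integrable (fun t => ψ x t * u t) (μ₁ x) := hψ.integrable_mul hu
  have heven : Integrable (fun t => 2⁻¹ * (φ x t * u t + φ x (-t) * u t)) (μ₁ x) :=
    (hφu.add hφ').const_mul _
  have hodd : Integrable (fun t => 2⁻¹ * (ψ x t * u t - ψ x (-t) * u t)) (μ₁ x) :=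
    (hψu.sub hψ').const_mul _
  simp only [integralOp, evenAddOdd, hφeq, hψeq, add_mul, sub_mul, mul_assoc]
  rw [integral_add heven hodd, integral_const_mul, integral_const_mul, integral_add hφu hφ',
    integral_sub hψu hψ']

theorem integralOp_seed (a u : ℝ → ℂ) (x : ℝ) :
    integralOp (seed a) u x = ∫ s in Ioc 0 x, a s * u (x - 2 * s) := by
  rcases lt_or_ge x 0 with hx | hx
  · rw [integralOp, Ioo_eq_empty (by linarith), Ioc_eq_empty hx.le.not_gt, setIntegral_empty,
      setIntegral_empty]
  set g : ℝ → ℂ := fun s => a s * u (x - 2 * s)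
  have hg : integralOp (seed a) u x = ∫ t in Ioo (-x) x, g (x / 2 - t / 2) / 2 := by
    refine setIntegral_congr_fun measurableSet_Ioo fun t ht => ?_
    simp only [g, seed, if_pos (abs_lt.2 ht), ← sub_div, mul_div_cancel₀ _ (two_ne_zero' ℝ),
      sub_sub_cancel]
    ring
  rw [hg, ← integral_Ioc_eq_integral_Ioo, ← intervalIntegral.integral_of_le (by linarith),
    ← intervalIntegral.integral_of_le hx, intervalIntegral.integral_div,
    intervalIntegral.integral_comp_sub_div g two_ne_zero (x / 2), sub_self, neg_div, sub_neg_eq_add,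
    add_halves, Complex.real_smul, Complex.ofReal_ofNat, mul_div_cancel_left₀ _ two_ne_zero]

theorem CharBound.integrable_prod_mul (ha : IsCoeff a) (hφ : CharBound c M φ) (hu : Continuous u)
    (x : ℝ) : Integrable (fun p : ℝ × ℝ => a p.1 * φ p.1 (x - p.1 - p.2) * u p.2)
      ((volume.restrict (Ioc 0 x)).prod (μ₁ x)) := by
  obtain ⟨B, hB⟩ := (isCompact_Icc (a := -x) (b := x)).exists_bound_of_continuousOn hu.continuousOn
  have hG : Integrable (fun p : ℝ × ℝ => a p.1 * φ p.1 (x - p.1 - p.2))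
      ((volume.restrict (Ioc 0 x)).prod (μ₁ x)) := by
    have hmeas : StronglyMeasurable fun p : ℝ × ℝ => a p.1 * φ p.1 (x - p.1 - p.2) :=
      (ha.meas.comp_measurable measurable_fst).mul (hφ.meas.comp_measurable
        (show Measurable fun p : ℝ × ℝ => (p.1, x - p.1 - p.2) by fun_prop))
    rw [integrable_prod_iff' hmeas.aestronglyMeasurable]
    refine ⟨ae_of_all _ fun t => hφ.integrableOn_mul ha x t, ?_⟩
    refine Integrable.of_bound hmeas.norm.integral_prod_left'.aestronglyMeasurable
      (lpNorm a 2 volume * M * Real.exp (c * x)) (ae_of_all _ fun t => ?_)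
    rw [Real.norm_of_nonneg (integral_nonneg fun s => norm_nonneg _)]
    exact hφ.integral_norm_mul_le ha x t
  have hB' : ∀ᵐ t ∂μ₁ x, ‖u t‖ ≤ B :=
    (ae_restrict_mem measurableSet_Ioo).mono fun t ht => hB t (Ioo_subset_Icc_self ht)
  exact hG.mul_bdd (hu.comp continuous_snd).aestronglyMeasurable
    (Measure.quasiMeasurePreserving_snd.ae hB')

theorem integralOp_volterra (ha : IsCoeff a) (hφ : CharBound c M φ) (hu : Continuous u) (x : ℝ) :
    integralOp (volterra a φ) u x =
      ∫ s in Ioc 0 x, a s * integralOp φ (fun r => u (x - s - r)) s := by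
  calc integralOp (volterra a φ) u x
      = ∫ t in Ioo (-x) x, ∫ s in Ioc 0 x, a s * φ s (x - s - t) * u t := by
        simp only [integralOp, volterra, integral_mul_const]
    _ = ∫ s in Ioc 0 x, ∫ t in Ioo (-x) x, a s * φ s (x - s - t) * u t :=
        (integral_integral_swap (hφ.integrable_prod_mul ha hu x)).symm
    _ = ∫ s in Ioc 0 x, a s * integralOp φ (fun r => u (x - s - r)) s := by
        refine setIntegral_congr_fun measurableSet_Ioc fun s hs => ?_
        have hout (t : ℝ) (ht : t ∉ Ioo (-x) x) : φ s (x - s - t) * u t = 0 := by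
          rw [hφ.eq_zero_of_le_abs, zero_mul]
          by_contra! h
          exact ht ⟨by linarith [abs_lt.1 h, hs.2], by linarith [abs_lt.1 h]⟩
        have hin (r : ℝ) (hr : r ∉ Ioo (-s) s) : φ s r * u (x - s - r) = 0 := by
          rw [hφ.eq_zero_of_le_abs _ _ (le_of_not_gt fun h => hr (abs_lt.1 h)), zero_mul]
        simp only [mul_assoc, integral_const_mul, integralOp]
        rw [setIntegral_eq_integral_of_forall_compl_eq_zero hout,
          setIntegral_eq_integral_of_forall_compl_eq_zero hin,
          ← integral_sub_left_eq_self _ volume (x - s)]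
        simp only [sub_sub_cancel]

end Slice

/-! ### Plane waves and the system `y' = a y + w`, `w' = -a w - ρ² y` -/

/-- The exponential `t ↦ exp (iρt)`. -/
def planeWave (ρ : ℂ) (t : ℝ) : ℂ := Complex.exp (Complex.I * ρ * t)

/-- The transform `exp (iρx) + ∫_{-x}^{x} S(x, t) exp (iρt) dt` of the Goursat solution `S`. It
solves `z(ρ)' = iρ z(ρ) + a z(-ρ)`, `z(ρ)(0) = 1`. -/
def jost (a : ℝ → ℂ) (ρ : ℂ) (x : ℝ) : ℂ := planeWave ρ x + integralOp (goursat a) (planeWave ρ) x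

/-- The transmutation kernel attached to a coefficient `a`. -/
def transKernel (a : ℝ → ℂ) : ℝ → ℝ → ℂ := evenAddOdd (goursat a) (goursat (-a))

/-- The Lipschitz constant of `a ↦ goursat a`, `‖a‖₂ ≤ Λ`, in the slice norms on `(0, ℓ]`. -/
def sliceConst (Λ ℓ : ℝ) : ℝ := 1 + 3 * Λ * Real.exp (rate Λ * ℓ) * √(2 * ℓ)

/-- The first order form of the Cauchy problem `-y'' + (a² + a') y = ρ² y`, `y 0 = 1`,
`(y' - a y) 0 = iρ`, with `w = y' - a y`. -/
structure IsSystemSolution (ℓ : ℝ) (a : ℝ → ℂ) (ρ : ℂ) (y w : ℝ → ℂ) : Prop where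
  deriv_fst : HasW12Deriv ℓ y fun x => a x * y x + w x
  deriv_snd : HasW12Deriv ℓ w fun x => -(a x * w x) - ρ ^ 2 * y x
  fst_zero : y 0 = 1
  snd_zero : w 0 = Complex.I * ρ

section System

variable {a a' : ℝ → ℂ} {ℓ x Λ : ℝ}

theorem planeWave_zero (ρ : ℂ) : planeWave ρ 0 = 1 := by simp [planeWave]

theorem planeWave_neg (ρ : ℂ) (t : ℝ) : planeWave (-ρ) t = planeWave ρ (-t) := by
  simp [planeWave]

theorem planeWave_sub (ρ : ℂ) (s t : ℝ) :
    planeWave ρ (s - t) = planeWave ρ s * planeWave (-ρ) t := by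
  simp only [planeWave, ← Complex.exp_add]
  congr 1
  push_cast
  ring

theorem contDiff_planeWave (ρ : ℂ) : ContDiff ℝ 1 (planeWave ρ) :=
  (contDiff_const.mul Complex.ofRealCLM.contDiff).cexp

theorem continuous_planeWave (ρ : ℂ) : Continuous (planeWave ρ) := (contDiff_planeWave ρ).continuous

theorem deriv_planeWave (ρ : ℂ) (x : ℝ) :
    deriv (planeWave ρ) x = Complex.I * ρ * planeWave ρ x := by
  have h : HasDerivAt (planeWave ρ) _ x :=
    ((Complex.ofRealCLM.hasDerivAt (x := x)).const_mul (Complex.I * ρ)).cexp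
  simpa [planeWave, mul_comm] using h.deriv

theorem memLp_planeWave (ρ : ℂ) (ℓ : ℝ) : MemLp (planeWave ρ) 2 (μ₁ ℓ) :=
  (memLp_top_of_continuousOn (continuous_planeWave ρ).continuousOn).mono_exponent le_top

theorem isConeKernel_goursat (ha : IsCoeff a) : IsConeKernel (goursat a) :=
  (charBound_goursat ha le_rfl).toIsConeKernel

theorem isConeKernel_transKernel (ha : IsCoeff a) : IsConeKernel (transKernel a) :=
  (isConeKernel_goursat ha).evenAddOdd (isConeKernel_goursat ha.neg)

theorem exists_sliceBound_goursat (ha : IsCoeff a) (ℓ : ℝ) : ∃ C, SliceBound ℓ C (goursat a) := by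
  have h := (sliceBound_seed (ℓ := ℓ) ha).add
    ((supBound_goursat_sub_seed ha le_rfl).sliceBound (rate_pos _).le (sq_nonneg _))
  rw [add_sub_cancel] at h
  exact ⟨_, h⟩

theorem memLp_goursat (ha : IsCoeff a) (x : ℝ) : MemLp (goursat a x) 2 (μ₁ x) := by
  obtain ⟨C, hC⟩ := exists_sliceBound_goursat ha x
  exact hC.memLp

theorem exists_sliceBound_transKernel (ha : IsCoeff a) (ℓ : ℝ) :
    ∃ C, SliceBound ℓ C (transKernel a) := by
  obtain ⟨C, hC⟩ := exists_sliceBound_goursat ha ℓ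
  obtain ⟨C', hC'⟩ := exists_sliceBound_goursat ha.neg ℓ
  exact ⟨_, hC.evenAddOdd hC'⟩

theorem sliceBound_goursat_sub (ha : IsCoeff a) (ha' : IsCoeff a') (hΛ : lpNorm a 2 volume ≤ Λ)
    (hΛ' : lpNorm a' 2 volume ≤ Λ) :
    SliceBound ℓ (sliceConst Λ ℓ * lpNorm (a - a') 2 volume) (goursat a - goursat a') := by
  have hD : SupBound (rate Λ) (3 * Λ * lpNorm (a - a') 2 volume)
      (goursat a - seed a - (goursat a' - seed a')) :=
    ⟨(supBound_goursat_sub_seed ha hΛ).toIsConeKernel.sub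
      (supBound_goursat_sub_seed ha' hΛ').toIsConeKernel,
      norm_goursat_sub_seed_sub_le ha ha' hΛ hΛ'⟩
  have h := (sliceBound_seed (ha.sub ha')).add (hD.sliceBound (ℓ := ℓ) (rate_pos Λ).le
    (mul_nonneg (mul_nonneg zero_le_three (lpNorm_nonneg.trans hΛ)) lpNorm_nonneg))
  have hsum : seed (a - a') + (goursat a - seed a - (goursat a' - seed a')) =
      goursat a - goursat a' := by
    rw [seed_sub]
    abel
  rw [hsum] at h
  convert h using 1
  rw [sliceConst]
  ring

theorem sliceBound_transKernel_sub (ha : IsCoeff a) (ha' : IsCoeff a')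
    (hΛ : lpNorm a 2 volume ≤ Λ) (hΛ' : lpNorm a' 2 volume ≤ Λ) :
    SliceBound ℓ (2 * sliceConst Λ ℓ * lpNorm (a - a') 2 volume)
      (transKernel a - transKernel a') := by
  have h := (sliceBound_goursat_sub (ℓ := ℓ) ha ha' hΛ hΛ').evenAddOdd
    (sliceBound_goursat_sub ha.neg ha'.neg (Λ := Λ) (by rwa [lpNorm_neg]) (by rwa [lpNorm_neg]))
  rw [show -a - -a' = -(a - a') by abel, lpNorm_neg, ← two_mul, ← mul_assoc] at h
  convert h using 1
  ext x t
  simp only [transKernel, evenAddOdd, Pi.sub_apply]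
  ring

theorem memLp_top_jost (ha : IsCoeff a) (ρ : ℂ) (ℓ : ℝ) : MemLp (jost a ρ) ⊤ (μ₀ ℓ) := by
  obtain ⟨C, hC⟩ := exists_sliceBound_goursat ha ℓ
  exact (memLp_top_of_continuousOn (continuous_planeWave ρ).continuousOn).add
    (hC.memLp_top_integralOp (isConeKernel_goursat ha).meas
      (continuous_planeWave ρ).stronglyMeasurable (memLp_planeWave ρ ℓ))

theorem memLp_two_mul_continuous_mul (ha : IsCoeff a) {u v : ℝ → ℂ} (hu : Continuous u)
    (hv : MemLp v ⊤ (μ₀ ℓ)) : MemLp (fun s => a s * (u s * v s)) 2 (μ₀ ℓ) :=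
  MemLp.mul' (p := 2) (q := ⊤) (r := 2) (MemLp.mul' (p := ⊤) (q := ⊤) (r := ⊤) hv
    (memLp_top_of_continuousOn hu.continuousOn)) (ha.memLp.restrict _)

theorem integralOp_goursat_planeWave (ha : IsCoeff a) (ρ : ℂ) (x : ℝ) :
    integralOp (goursat a) (planeWave ρ) x =
      ∫ s in Ioc 0 x, a s * (planeWave ρ (x - s) * jost a (-ρ) s) := by
  obtain ⟨C, hC⟩ := exists_sliceBound_goursat ha x
  have hS := charBound_goursat ha le_rfl
  have hcont := continuous_planeWave (-ρ)
  have hint {v : ℝ → ℂ} (hv : MemLp v ⊤ (μ₀ x)) :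
      Integrable (fun s => a s * (planeWave ρ (x - s) * v s)) (volume.restrict (Ioc 0 x)) := by
    rw [← restrict_Ioo_eq_restrict_Ioc]
    exact (memLp_two_mul_continuous_mul ha
      ((continuous_planeWave ρ).comp (continuous_sub_left x)) hv).integrable one_le_two
  have hseed : integralOp (seed a) (planeWave ρ) x =
      ∫ s in Ioc 0 x, a s * (planeWave ρ (x - s) * planeWave (-ρ) s) := by
    simp only [integralOp_seed, two_mul, ← sub_sub, planeWave_sub ρ (x - _)]
  have hvolterra : integralOp (volterra a (goursat a)) (planeWave ρ) x =
      ∫ s in Ioc 0 x, a s * (planeWave ρ (x - s) * integralOp (goursat a) (planeWave (-ρ)) s) := by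
    simp only [integralOp_volterra ha hS (continuous_planeWave ρ), planeWave_sub ρ (x - _)]
    simp only [integralOp, mul_left_comm _ (planeWave ρ (x - _)), integral_const_mul]
  have hsplit : integralOp (goursat a) (planeWave ρ) x =
      integralOp (seed a) (planeWave ρ) x +
        integralOp (volterra a (goursat a)) (planeWave ρ) x := by
    conv_lhs => rw [goursat_eq_seed_add_volterra ha]
    exact integralOp_add (sliceBound_seed ha).memLp ((hS.supBound_volterra ha).sliceBound
      (rate_pos _).le (mul_nonneg lpNorm_nonneg lpNorm_nonneg)).memLp (memLp_planeWave ρ x)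
  rw [hsplit, hseed, hvolterra, ← integral_add (hint (memLp_top_of_continuousOn hcont.continuousOn))
    (hint (hC.memLp_top_integralOp (isConeKernel_goursat ha).meas hcont.stronglyMeasurable
      (memLp_planeWave (-ρ) x)))]
  simp only [jost, mul_add]

theorem jost_eq (ha : IsCoeff a) (ρ : ℂ) (hx : 0 ≤ x) : jost a ρ x = planeWave ρ x *
    (1 + ∫ s in (0 : ℝ)..x, a s * (planeWave (-ρ) s * jost a (-ρ) s)) := by
  rw [jost, integralOp_goursat_planeWave ha, intervalIntegral.integral_of_le hx, mul_add, mul_one,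
    ← integral_const_mul]
  simp only [planeWave_sub, mul_assoc, mul_left_comm (planeWave ρ x)]

theorem jost_zero (ha : IsCoeff a) (ρ : ℂ) : jost a ρ 0 = 1 := by
  rw [jost_eq ha ρ le_rfl, planeWave_zero, intervalIntegral.integral_same, add_zero, mul_one]

theorem hasW12Deriv_jost (hℓ : 0 ≤ ℓ) (ha : IsCoeff a) (ρ : ℂ) : HasW12Deriv ℓ (jost a ρ)
    fun x => Complex.I * ρ * jost a ρ x + a x * jost a (-ρ) x := by
  set U : ℝ → ℂ := fun x => 1 + ∫ s in (0 : ℝ)..x, a s * (planeWave (-ρ) s * jost a (-ρ) s)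
  have hU : HasW12Deriv ℓ U fun x => a x * (planeWave (-ρ) x * jost a (-ρ) x) :=
    HasW12Deriv.of_eq_add_integral hℓ (memLp_two_mul_continuous_mul ha (continuous_planeWave (-ρ))
      (memLp_top_jost ha (-ρ) ℓ)) fun x _ => rfl
  have hprod := (HasW12Deriv.of_contDiff (contDiff_planeWave ρ)).mul hℓ hU
  have hjost := HasW12Deriv.of_eq_add_integral hℓ hprod.memLp fun x hx =>
    (jost_eq ha ρ hx.1).trans (hprod.eq_add_integral hℓ hx)
  refine hjost.congr_deriv ?_
  filter_upwards [ae_restrict_mem measurableSet_Ioo] with x hx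
  have hone : planeWave ρ x * planeWave (-ρ) x = 1 := by
    rw [← planeWave_sub, sub_self, planeWave_zero]
  rw [deriv_planeWave, jost_eq ha ρ hx.1.le]
  linear_combination a x * jost a (-ρ) x * hone

theorem planeWave_add_integralOp_transKernel (ha : IsCoeff a) (ρ : ℂ) (x : ℝ) :
    planeWave ρ x + integralOp (transKernel a) (planeWave ρ) x =
      2⁻¹ * (jost a ρ x + jost a (-ρ) x) + 2⁻¹ * (jost (-a) ρ x - jost (-a) (-ρ) x) := by
  rw [transKernel, integralOp_evenAddOdd (memLp_goursat ha x) (memLp_goursat ha.neg x)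
    (memLp_planeWave ρ x)]
  simp only [← planeWave_neg, jost]
  ring

theorem exists_isSystemSolution (hℓ : 0 ≤ ℓ) (ha : IsCoeff a) (ρ : ℂ) : ∃ w,
    IsSystemSolution ℓ a ρ (fun x => planeWave ρ x + integralOp (transKernel a) (planeWave ρ) x)
      w := by
  simp only [planeWave_add_integralOp_transKernel ha]
  have hpos := hasW12Deriv_jost hℓ ha ρ
  have hneg := hasW12Deriv_jost hℓ ha (-ρ)
  have hpos' := hasW12Deriv_jost hℓ ha.neg ρ
  have hneg' := hasW12Deriv_jost hℓ ha.neg (-ρ)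
  rw [neg_neg] at hneg hneg'
  refine ⟨fun x => Complex.I * ρ * 2⁻¹ *
      ((jost a ρ x - jost a (-ρ) x) + (jost (-a) ρ x + jost (-a) (-ρ) x)), ?_, ?_, ?_, ?_⟩
  · refine ((((hpos.add hℓ hneg).const_mul 2⁻¹).add hℓ
      ((hpos'.sub hℓ hneg').const_mul 2⁻¹))).congr_deriv (ae_of_all _ fun x => ?_)
    simp only [Pi.neg_apply]
    ring
  · refine (((hpos.sub hℓ hneg).add hℓ (hpos'.add hℓ hneg')).const_mul
      (Complex.I * ρ * 2⁻¹)).congr_deriv (ae_of_all _ fun x => ?_)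
    simp only [Pi.neg_apply]
    linear_combination (ρ ^ 2 * 2⁻¹ * (jost a ρ x + jost a (-ρ) x + (jost (-a) ρ x -
      jost (-a) (-ρ) x))) * Complex.I_sq
  · simp only [jost_zero ha, jost_zero ha.neg]
    norm_num
  · simp only [jost_zero ha, jost_zero ha.neg]
    ring

end System

/-! ### Equivalence of the Schrödinger equation and the system -/

/-- The coefficient `f'/f` of the system on `(0, ℓ)`, extended by zero to the line. -/
def coeff (ℓ : ℝ) (f : ℝ → ℂ) : ℝ → ℂ := (Ioo 0 ℓ).indicator (logD f)

section Schrodinger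

variable {ℓ : ℝ} {a b f y y' w w' φ : ℝ → ℂ} {ρ : ℂ}

theorem coeff_ae_eq (ℓ : ℝ) (f : ℝ → ℂ) : coeff ℓ f =ᵐ[μ₀ ℓ] logD f :=
  indicator_ae_eq_restrict measurableSet_Ioo

theorem lpNorm_coeff (ℓ : ℝ) (f : ℝ → ℂ) :
    lpNorm (coeff ℓ f) 2 volume = lpNorm (logD f) 2 (μ₀ ℓ) :=
  lpNorm_indicator measurableSet_Ioo

theorem lpNorm_coeff_sub (ℓ : ℝ) (f g : ℝ → ℂ) :
    lpNorm (coeff ℓ f - coeff ℓ g) 2 volume = lpNorm (logD f - logD g) 2 (μ₀ ℓ) := by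
  rw [coeff, coeff, ← indicator_sub']
  exact lpNorm_indicator measurableSet_Ioo

theorem IsImpedance.memLp_logD (hℓ : 0 ≤ ℓ) (hf : IsImpedance ℓ f) : MemLp (logD f) 2 (μ₀ ℓ) :=
  memLp_two_mul_continuousOn hf.memW12.deriv_memLp
    ((hf.memW12.continuousOn hℓ).inv₀ hf.ne_zero)

theorem IsImpedance.isCoeff (hℓ : 0 ≤ ℓ) (hf : IsImpedance ℓ f) : IsCoeff (coeff ℓ f) where
  meas := by
    have hinv : Measurable ((Ioo 0 ℓ).piecewise f⁻¹ fun _ => 0) :=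
      (((hf.memW12.continuousOn hℓ).inv₀ hf.ne_zero).mono Ioo_subset_Icc_self).measurable_piecewise
        continuousOn_const measurableSet_Ioo
    have h : coeff ℓ f = fun x => deriv f x * (Ioo 0 ℓ).piecewise f⁻¹ (fun _ => 0) x := by
      funext x
      simp only [coeff, indicator_apply, piecewise, logD, div_eq_mul_inv, Pi.inv_apply, mul_ite,
        mul_zero]
    rw [h]
    exact ((measurable_deriv f).mul hinv).stronglyMeasurable
  memLp := (memLp_indicator_iff_restrict measurableSet_Ioo).2 (hf.memLp_logD hℓ)

theorem IsSystemSolution.congr_coeff (h : IsSystemSolution ℓ a ρ y w) (hab : a =ᵐ[μ₀ ℓ] b) :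
    IsSystemSolution ℓ b ρ y w where
  deriv_fst := h.deriv_fst.congr_deriv (hab.mono fun x hx => by simp only [hx])
  deriv_snd := h.deriv_snd.congr_deriv (hab.mono fun x hx => by simp only [hx])
  fst_zero := h.fst_zero
  snd_zero := h.snd_zero

theorem IsSystemSolution.eqOn (hℓ : 0 ≤ ℓ) (ha : MemLp a 2 (μ₀ ℓ)) (h : IsSystemSolution ℓ a ρ y w)
    (h' : IsSystemSolution ℓ a ρ y' w') : EqOn y y' (Icc 0 ℓ) := by
  have hY := h.deriv_fst.sub hℓ h'.deriv_fst
  have hW := h.deriv_snd.sub hℓ h'.deriv_snd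
  set N : ℝ → ℝ := fun x => ‖y x - y' x‖ + ‖w x - w' x‖ with hN
  set k : ℝ → ℝ := fun x => ‖a x‖ + (1 + ‖ρ ^ 2‖) with hk
  have hk2 : MemLp k 2 (μ₀ ℓ) := ha.norm.add (memLp_const _)
  have hNcont : ContinuousOn N (Icc 0 ℓ) :=
    (hY.memW12.continuousOn hℓ).norm.add (hW.memW12.continuousOn hℓ).norm
  obtain ⟨M, hM⟩ := isCompact_Icc.exists_bound_of_continuousOn hNcont
  have hkN : MemLp (fun s => ‖k s‖ * N s) 2 (μ₀ ℓ) :=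
    MemLp.mul' (p := 2) (q := ⊤) (r := 2) (memLp_top_of_continuousOn hNcont) hk2.norm
  have hint {v : ℝ → ℝ} {x : ℝ} (hx : x ∈ Icc 0 ℓ) (hv : MemLp v 2 (μ₀ ℓ)) :
      IntegrableOn v (Ioc 0 x) := (memLp_restrict_Ioc hx.2 hv).integrable one_le_two
  have hle : ∀ x ∈ Icc 0 ℓ, N x ≤ ∫ s in Ioc 0 x, ‖k s‖ * N s := fun x hx => by
    refine (add_le_add (hY.norm_le_integral hℓ (by simp [h.fst_zero, h'.fst_zero]) hx)
      (hW.norm_le_integral hℓ (by simp [h.snd_zero, h'.snd_zero]) hx)).trans ?_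
    rw [← integral_add (hint hx hY.memLp.norm) (hint hx hW.memLp.norm)]
    refine integral_mono ((hint hx hY.memLp.norm).add (hint hx hW.memLp.norm)) (hint hx hkN)
      fun s => ?_
    have hfst : ‖a s * y s + w s - (a s * y' s + w' s)‖ ≤
        ‖a s‖ * ‖y s - y' s‖ + ‖w s - w' s‖ := by
      rw [← norm_mul]
      exact (congrArg _ (by ring)).trans_le (norm_add_le _ _)
    have hsnd : ‖-(a s * w s) - ρ ^ 2 * y s - (-(a s * w' s) - ρ ^ 2 * y' s)‖ ≤
        ‖a s‖ * ‖w s - w' s‖ + ‖ρ ^ 2‖ * ‖y s - y' s‖ := by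
      rw [← norm_mul, ← norm_mul, ← norm_neg (a s * _)]
      exact (congrArg _ (by ring)).trans_le (norm_sub_le _ _)
    rw [hk, hN, Real.norm_of_nonneg (by positivity)]
    nlinarith [mul_nonneg (norm_nonneg (ρ ^ 2)) (norm_nonneg (w s - w' s)),
      norm_nonneg (y s - y' s)]
  intro x hx
  have hzero := eq_zero_of_le_integral_norm_mul hk2 (fun x _ => by positivity)
    (fun x hx => (le_abs_self _).trans (hM x hx)) hle hx
  exact sub_eq_zero.1 (norm_le_zero_iff.1 (by linarith [norm_nonneg (w x - w' x)]))

theorem schrodinger_eq (hℓ : 0 ≤ ℓ) (hf : MemLp (logD f) 2 (μ₀ ℓ)) (hy : MemW12 ℓ y)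
    (hw : HasW12Deriv ℓ w w') (hyw : w =ᵐ[μ₀ ℓ] quasiDeriv f y) (hφ : MemW12Zero ℓ φ) :
    schrodinger ℓ f y φ = -∫ x in (0 : ℝ)..ℓ, (w' x + logD f x * w x) * φ x := by
  have hyφ := hy.hasW12Deriv.mul hℓ hφ.memW12.hasW12Deriv
  have cw := hw.memW12.continuousOn hℓ
  have cφ := hφ.memW12.continuousOn hℓ
  have hprod {u v : ℝ → ℂ} (hu : MemLp u 2 (μ₀ ℓ)) (hv : MemLp v 2 (μ₀ ℓ)) :
      IntervalIntegrable (fun x => u x * v x) volume 0 ℓ :=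
    (intervalIntegrable_iff_integrableOn_Ioo_of_le hℓ).2 (hu.integrable_mul hv)
  have hfwφ := intervalIntegrable_of_memLp_two hℓ
    (memLp_two_mul_continuousOn (memLp_two_mul_continuousOn hf cw) cφ)
  have hq : IntervalIntegrable (fun x => logD f x ^ 2 * (y x * φ x) -
      logD f x * deriv (fun x => y x * φ x) x) volume 0 ℓ := by
    simpa only [pow_two, mul_assoc] using
      (hprod hf (memLp_two_mul_continuousOn hf (hyφ.memW12.continuousOn hℓ))).sub
        (hprod hf hyφ.memW12.deriv_memLp)
  have hcancel : (fun x => deriv y x * deriv φ x + (logD f x ^ 2 * (y x * φ x) -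
      logD f x * deriv (fun x => y x * φ x) x)) =ᵐ[μ₀ ℓ]
        fun x => w x * deriv φ x - logD f x * w x * φ x := by
    filter_upwards [hyw, hyφ.deriv_ae_eq] with x hwx hderiv
    rw [hderiv, hwx, quasiDeriv]
    ring
  rw [schrodinger, potential,
    ← intervalIntegral.integral_add (hprod hy.deriv_memLp hφ.memW12.deriv_memLp) hq,
    intervalIntegral_congr_ae_mu₀ hcancel (right_mem_Icc.2 hℓ), intervalIntegral.integral_sub
      ((intervalIntegrable_of_memLp_two hℓ hφ.memW12.deriv_memLp).continuousOn_mul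
        (by rwa [uIcc_of_le hℓ])) hfwφ, hw.integral_mul_deriv hℓ hφ]
  simp only [add_mul]
  rw [intervalIntegral.integral_add
    (intervalIntegrable_of_memLp_two hℓ (memLp_two_mul_continuousOn hw.memLp cφ)) hfwφ]
  ring

theorem IsSystemSolution.isExpSolution (hℓ : 0 ≤ ℓ) (hf : MemLp (logD f) 2 (μ₀ ℓ))
    (h : IsSystemSolution ℓ (logD f) ρ y w) : IsExpSolution ℓ f ρ y := by
  have hyw : w =ᵐ[μ₀ ℓ] quasiDeriv f y := by
    filter_upwards [h.deriv_fst.deriv_ae_eq] with x hx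
    rw [quasiDeriv, hx, add_sub_cancel_left]
  refine ⟨h.deriv_fst.memW12, fun φ hφ => ?_, h.fst_zero, w, h.deriv_snd.memW12, hyw, h.snd_zero⟩
  rw [schrodinger_eq hℓ hf h.deriv_fst.memW12 h.deriv_snd hyw hφ, ← intervalIntegral.integral_neg]
  congr 1 with x
  ring

theorem ae_eq_zero_of_integral_mul_memW12Zero_eq_zero (hℓ : 0 ≤ ℓ) {v : ℝ → ℂ}
    (hv : MemLp v 2 (μ₀ ℓ))
    (h : ∀ φ : ℝ → ℂ, MemW12Zero ℓ φ → ∫ x in (0 : ℝ)..ℓ, v x * φ x = 0) : v =ᵐ[μ₀ ℓ] 0 := by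
  have hloc : LocallyIntegrableOn v (Ioo 0 ℓ) :=
    IntegrableOn.locallyIntegrableOn (hv.integrable one_le_two)
  have hzero := isOpen_Ioo.ae_eq_zero_of_integral_contDiff_smul_eq_zero hloc fun g hg _ hsupp => by
    have hg0 : ∀ x ∉ Ioo 0 ℓ, g x = 0 := fun x hx =>
      image_eq_zero_of_notMem_tsupport fun hx' => hx (hsupp hx')
    have hφ : MemW12Zero ℓ fun x => (g x : ℂ) :=
      ⟨(HasW12Deriv.of_contDiff
        (Complex.ofRealCLM.contDiff.comp (hg.of_le (mod_cast le_top)))).memW12,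
        by simp [hg0 0 (by simp)], by simp [hg0 ℓ (by simp)]⟩
    rw [← h _ hφ, intervalIntegral.integral_of_le hℓ, integral_Ioc_eq_integral_Ioo,
      ← setIntegral_eq_integral_of_forall_compl_eq_zero (s := Ioo 0 ℓ)
        fun x hx => by rw [hg0 x hx, zero_smul]]
    simp only [Complex.real_smul, mul_comm]
  rw [EventuallyEq, ae_restrict_iff' measurableSet_Ioo]
  exact hzero

theorem IsExpSolution.exists_isSystemSolution (hℓ : 0 ≤ ℓ) (hf : MemLp (logD f) 2 (μ₀ ℓ))
    (hy : IsExpSolution ℓ f ρ y) : ∃ w, IsSystemSolution ℓ (logD f) ρ y w := by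
  obtain ⟨w, hw, hyw, hw0⟩ := hy.init_quasi
  have hsum : MemLp (fun x => deriv w x + logD f x * w x) 2 (μ₀ ℓ) :=
    hw.deriv_memLp.add (memLp_two_mul_continuousOn hf (hw.continuousOn hℓ))
  have hρy : MemLp (fun x => ρ ^ 2 * y x) 2 (μ₀ ℓ) :=
    ((memLp_top_of_continuousOn (hy.memW12.continuousOn hℓ)).mono_exponent le_top).const_mul _
  have hzero := ae_eq_zero_of_integral_mul_memW12Zero_eq_zero hℓ (hsum.add hρy) fun φ hφ => by
    have cφ := hφ.memW12.continuousOn hℓ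
    have heq := hy.equation φ hφ
    rw [schrodinger_eq hℓ hf hy.memW12 hw.hasW12Deriv hyw hφ, neg_eq_iff_add_eq_zero,
      ← intervalIntegral.integral_add
        (intervalIntegrable_of_memLp_two hℓ (memLp_two_mul_continuousOn hsum cφ))
        (intervalIntegrable_of_memLp_two hℓ (memLp_two_mul_continuousOn hρy cφ))] at heq
    simpa only [Pi.add_apply, add_mul] using heq
  refine ⟨w, hy.memW12.hasW12Deriv.congr_deriv ?_, hw.hasW12Deriv.congr_deriv ?_, hy.init, hw0⟩
  · filter_upwards [hyw] with x hx
    rw [hx, quasiDeriv, add_sub_cancel]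
  · filter_upwards [hzero] with x hx
    simp only [Pi.add_apply, Pi.zero_apply] at hx
    linear_combination hx

theorem IsExpSolution.eqOn (hℓ : 0 ≤ ℓ) (hf : MemLp (logD f) 2 (μ₀ ℓ))
    (hy : IsExpSolution ℓ f ρ y) (hy' : IsExpSolution ℓ f ρ y') : EqOn y y' (Icc 0 ℓ) := by
  obtain ⟨w, hw⟩ := hy.exists_isSystemSolution hℓ hf
  obtain ⟨w', hw'⟩ := hy'.exists_isSystemSolution hℓ hf
  exact hw.eqOn hℓ hf hw'

end Schrodinger

/-! ### Existence and uniqueness of the transmutation kernel -/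

section Kernel

variable {ℓ x C : ℝ} {f v : ℝ → ℂ} {K K' : ℝ → ℝ → ℂ}

theorem ae_eq_zero_of_integral_mul_planeWave_eq_zero (hv : MemLp v 2 (μ₁ x))
    (h : ∀ ρ : ℂ, ∫ t in Ioo (-x) x, v t * planeWave ρ t = 0) : v =ᵐ[μ₁ x] 0 := by
  rcases le_or_gt x 0 with hx | hx
  · rw [μ₁, Ioo_eq_empty (by linarith), Measure.restrict_empty, EventuallyEq, ae_zero]
    exact eventually_bot
  have hlt : -x < x := by linarith
  have hcoeff (n : ℤ) : fourierCoeffOn hlt v n = 0 := by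
    rw [fourierCoeffOn_eq_integral, intervalIntegral.integral_of_le hlt.le,
      integral_Ioc_eq_integral_Ioo]
    convert smul_zero (1 / (x - -x)) using 2
    rw [← h (-(2 * Real.pi * n / (x - -x)))]
    refine integral_congr_ae (ae_of_all _ fun t => ?_)
    simp only [fourier_coe_apply, smul_eq_mul, planeWave, mul_comm (v t)]
    congr 2
    push_cast
    ring
  have hsum := hasSum_sq_fourierCoeffOn hlt (f := v) (by rwa [← restrict_Ioo_eq_restrict_Ioc])
  simp only [hcoeff, norm_zero, zero_pow two_ne_zero] at hsum
  have hnorm := hsum.unique hasSum_zero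
  rw [smul_eq_zero_iff_right (inv_ne_zero (by linarith)),
    intervalIntegral.integral_of_le hlt.le, integral_Ioc_eq_integral_Ioo] at hnorm
  rw [← lpNorm_eq_zero hv two_ne_zero, lpNorm_two_eq_sqrt hv.1, hnorm, Real.sqrt_zero]

theorem topologicalClosure_span_planeWave (ℓ : ℝ) :
    (Submodule.span ℂ (range fun ρ => (memLp_planeWave ρ ℓ).toLp (planeWave ρ))).topologicalClosure
      = ⊤ := by
  rw [Submodule.topologicalClosure_eq_top_iff, Submodule.eq_bot_iff]
  intro v hv
  rw [Lp.eq_zero_iff_ae_eq_zero]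
  refine ae_eq_zero_of_integral_mul_planeWave_eq_zero (Lp.memLp v) fun ρ => ?_
  set σ : ℂ := -(starRingEnd ℂ) ρ
  rw [← hv _ (Submodule.subset_span (mem_range_self σ)), L2.inner_def]
  refine integral_congr_ae ?_
  filter_upwards [(memLp_planeWave σ ℓ).coeFn_toLp] with t ht
  rw [ht]
  simp only [RCLike.inner_apply, planeWave, ← Complex.exp_conj, σ, map_mul, map_neg,
    Complex.conj_I, Complex.conj_conj, Complex.conj_ofReal, neg_mul_neg]

theorem lintegral_μT {g : ℝ × ℝ → ENNReal} (hg : AEMeasurable g (μT ℓ)) :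
    ∫⁻ p, g p ∂μT ℓ = ∫⁻ x in Ioo 0 ℓ, ∫⁻ t in Ioo (-x) x, g (x, t) := by
  have hmeas : MeasurableSet (triangle ℓ) :=
    (measurableSet_le measurable_const measurable_fst).inter
      ((measurableSet_le measurable_fst measurable_const).inter
        (measurableSet_le measurable_snd.norm measurable_fst))
  rw [← lintegral_indicator hmeas, Measure.volume_eq_prod, lintegral_prod _
    ((aemeasurable_indicator_iff hmeas).2 hg), setLIntegral_congr Ioo_ae_eq_Icc,
    ← lintegral_indicator measurableSet_Icc]
  refine lintegral_congr fun x => ?_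
  by_cases hx : x ∈ Icc 0 ℓ
  · rw [indicator_of_mem hx, setLIntegral_congr Ioo_ae_eq_Icc,
      ← lintegral_indicator measurableSet_Icc]
    simp only [indicator_apply, triangle, mem_ofPred_eq, mem_Icc, hx.1, hx.2,
      true_and, abs_le]
  · have hout (t : ℝ) : (x, t) ∉ triangle ℓ := fun ht => hx ⟨ht.1, ht.2.1⟩
    simp only [indicator_of_notMem hx, indicator_of_notMem (hout _), lintegral_zero]

namespace SliceBound

theorem congr (hK : SliceBound ℓ C K) (h : ∀ x ∈ Ioc 0 ℓ, K x =ᵐ[μ₁ x] K' x) :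
    SliceBound ℓ C K' := fun x hx =>
  ⟨(hK x hx).1.ae_eq (h x hx), (lpNorm_congr_ae (h x hx)).symm.trans_le (hK x hx).2⟩

theorem eLpNorm_μT_le (hℓ : 0 ≤ ℓ) (hK : SliceBound ℓ C K)
    (hmeas : AEStronglyMeasurable (fun p : ℝ × ℝ => K p.1 p.2) (μT ℓ)) :
    eLpNorm (fun p : ℝ × ℝ => K p.1 p.2) 2 (μT ℓ) ≤ ENNReal.ofReal (C * √ℓ) := by
  have hsq {α : Type} [MeasurableSpace α] (u : α → ℂ) (μ : Measure α) :
      eLpNorm u 2 μ ^ 2 = ∫⁻ x, ‖u x‖ₑ ^ 2 ∂μ := by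
    simpa using eLpNorm_nnreal_pow_eq_lintegral (f := u) (μ := μ) (p := 2) two_ne_zero
  have hslice : ∀ x ∈ Ioo 0 ℓ, ∫⁻ t in Ioo (-x) x, ‖K x t‖ₑ ^ 2 ≤ ENNReal.ofReal C ^ 2 := by
    intro x hx
    obtain ⟨hmem, hle⟩ := hK x (Ioo_subset_Ioc_self hx)
    rw [← hsq, ← ofReal_lpNorm hmem]
    gcongr
  rw [← ENNReal.pow_le_pow_left_iff two_ne_zero, hsq, lintegral_μT (hmeas.enorm.pow_const 2)]
  calc ∫⁻ x in Ioo 0 ℓ, ∫⁻ t in Ioo (-x) x, ‖K x t‖ₑ ^ 2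
      ≤ ∫⁻ _ in Ioo 0 ℓ, ENNReal.ofReal C ^ 2 := setLIntegral_mono' measurableSet_Ioo hslice
    _ = ENNReal.ofReal (C * √ℓ) ^ 2 := by
      rw [setLIntegral_const, Real.volume_Ioo, sub_zero, ENNReal.ofReal_mul' (Real.sqrt_nonneg _),
        mul_pow, ← ENNReal.ofReal_pow (Real.sqrt_nonneg _), Real.sq_sqrt hℓ]

end SliceBound

theorem intervalIntegral_eq_integralOp (hx : 0 ≤ x) (K : ℝ → ℝ → ℂ) (u : ℝ → ℂ) :
    ∫ t in (-x)..x, K x t * u t = integralOp K u x := by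
  rw [intervalIntegral.integral_of_le (by linarith), integral_Ioc_eq_integral_Ioo, integralOp]

theorem IsImpedance.isExpSolution (hℓ : 0 ≤ ℓ) (hf : IsImpedance ℓ f) (ρ : ℂ) :
    IsExpSolution ℓ f ρ fun x =>
      planeWave ρ x + integralOp (transKernel (coeff ℓ f)) (planeWave ρ) x := by
  obtain ⟨w, hw⟩ := exists_isSystemSolution hℓ (hf.isCoeff hℓ) ρ
  exact (hw.congr_coeff (coeff_ae_eq ℓ f)).isExpSolution hℓ (hf.memLp_logD hℓ)

theorem IsImpedance.isTransmutationKernel (hℓ : 0 ≤ ℓ) (hf : IsImpedance ℓ f) :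
    IsTransmutationKernel ℓ f (transKernel (coeff ℓ f)) := by
  have ha := hf.isCoeff hℓ
  obtain ⟨C, hC⟩ := exists_sliceBound_transKernel ha ℓ
  have hmeas := (isConeKernel_transKernel ha).meas.aestronglyMeasurable (μ := μT ℓ)
  refine ⟨⟨hmeas, (hC.eLpNorm_μT_le hℓ hmeas).trans_lt ENNReal.ofReal_lt_top⟩,
    fun x hx => (hC x hx).1, fun ρ => ⟨_, hf.isExpSolution hℓ ρ, fun x hx => ?_⟩⟩
  exact congrArg _ (intervalIntegral_eq_integralOp hx.1.le _ _).symm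

theorem IsTransmutationKernel.ae_eq (hℓ : 0 ≤ ℓ) (hf : MemLp (logD f) 2 (μ₀ ℓ))
    (hK : IsTransmutationKernel ℓ f K) (hK' : IsTransmutationKernel ℓ f K') (hx : x ∈ Ioc 0 ℓ) :
    K x =ᵐ[μ₁ x] K' x := by
  have hmem := hK.slice x hx
  have hmem' := hK'.slice x hx
  refine (sub_ae_eq_zero _ _).1
    (ae_eq_zero_of_integral_mul_planeWave_eq_zero (hmem.sub hmem') fun ρ => ?_)
  obtain ⟨y, hy, hrep⟩ := hK.representation ρ
  obtain ⟨y', hy', hrep'⟩ := hK'.representation ρ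
  have heq : integralOp K (planeWave ρ) x = integralOp K' (planeWave ρ) x := by
    rw [← intervalIntegral_eq_integralOp hx.1.le, ← intervalIntegral_eq_integralOp hx.1.le]
    refine add_left_cancel (a := planeWave ρ x) ?_
    exact (hrep x hx).symm.trans ((hy.eqOn hℓ hf hy' (Ioc_subset_Icc_self hx)).trans (hrep' x hx))
  exact (integralOp_sub hmem hmem' (memLp_planeWave ρ x)).trans (sub_eq_zero.2 heq)

theorem IsImpedance.isTransmutationKernel_kernel (hℓ : 0 ≤ ℓ) (hf : IsImpedance ℓ f) :
    IsTransmutationKernel ℓ f (kernel ℓ f) :=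
  Classical.epsilon_spec ⟨_, hf.isTransmutationKernel hℓ⟩

theorem IsImpedance.isUniqueTransmutationKernel (hℓ : 0 ≤ ℓ) (hf : IsImpedance ℓ f) :
    IsUniqueTransmutationKernel ℓ f (kernel ℓ f) :=
  ⟨hf.isTransmutationKernel_kernel hℓ, fun _ hK _ hx =>
    hK.ae_eq hℓ (hf.memLp_logD hℓ) (hf.isTransmutationKernel_kernel hℓ) hx⟩

theorem IsImpedance.transKernel_ae_eq_kernel (hℓ : 0 ≤ ℓ) (hf : IsImpedance ℓ f)
    (hx : x ∈ Ioc 0 ℓ) : transKernel (coeff ℓ f) x =ᵐ[μ₁ x] kernel ℓ f x :=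
  (hf.isUniqueTransmutationKernel hℓ).2 _ (hf.isTransmutationKernel hℓ) x hx

theorem IsImpedance.transmute_eq (hℓ : 0 ≤ ℓ) (hf : IsImpedance ℓ f) (u : ℝ → ℂ)
    (hx : x ∈ Icc 0 ℓ) :
    transmute ℓ f u x = u x + integralOp (transKernel (coeff ℓ f)) u x := by
  rw [transmute, intervalIntegral_eq_integralOp hx.1]
  rcases hx.1.eq_or_lt with rfl | hx0
  · simp only [integralOp, neg_zero, Ioo_self, setIntegral_empty]
  · congr 1
    refine integral_congr_ae ?_
    filter_upwards [hf.transKernel_ae_eq_kernel hℓ ⟨hx0, hx.2⟩] with t ht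
    rw [ht]

end Kernel

/-! ### Transmutation operators and their convergence -/

/-- `J` is the operator `u ↦ ∫_{-x}^{x} K(x, t) u(t) dt` from `L²(-ℓ, ℓ)` to `C[0, ℓ]`. -/
def IsIntegralCLM (ℓ : ℝ) (K : ℝ → ℝ → ℂ)
    (J : Lp ℂ 2 (μ₁ ℓ) →L[ℂ] C(Icc (0 : ℝ) ℓ, ℂ)) : Prop :=
  ∀ (u : Lp ℂ 2 (μ₁ ℓ)) (x : Icc (0 : ℝ) ℓ), J u x = integralOp K u x

section Operator

variable {ℓ x C : ℝ} {f u v : ℝ → ℂ} {K K' : ℝ → ℝ → ℂ}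
  {J J' : Lp ℂ 2 (μ₁ ℓ) →L[ℂ] C(Icc (0 : ℝ) ℓ, ℂ)}

theorem continuous_apply_of_topologicalClosure_eq_top {E X : Type*} [NormedAddCommGroup E]
    [NormedSpace ℂ E] [TopologicalSpace X] {L : E →ₗ[ℂ] X → ℂ} (hC : 0 ≤ C)
    (hL : ∀ u x, ‖L u x‖ ≤ C * ‖u‖) {p : Submodule ℂ E} (hp : p.topologicalClosure = ⊤)
    (hcont : ∀ v ∈ p, Continuous (L v)) (u : E) : Continuous (L u) := by
  refine continuous_of_uniform_approx_of_continuous fun s hs => ?_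
  obtain ⟨ε, hε, hs⟩ := Metric.mem_uniformity_dist.1 hs
  have hC' : 0 < C + 1 := by linarith
  have hu : u ∈ closure (p : Set E) := by
    rw [← Submodule.topologicalClosure_coe, hp]
    trivial
  obtain ⟨v, hv, huv⟩ := Metric.mem_closure_iff.1 hu (ε / (C + 1)) (div_pos hε hC')
  refine ⟨L v, hcont v hv, fun x => hs ?_⟩
  rw [dist_eq_norm, lt_div_iff₀ hC'] at huv
  rw [dist_eq_norm, ← Pi.sub_apply, ← map_sub]
  exact (hL _ x).trans_lt (by linarith [norm_nonneg (u - v)])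

theorem integralOp_congr_ae (K : ℝ → ℝ → ℂ) (h : u =ᵐ[μ₁ ℓ] v) (hx : x ≤ ℓ) :
    integralOp K u x = integralOp K v x :=
  integral_congr_ae ((h.filter_mono (ae_mono (μ₁_mono hx))).mono fun t ht =>
    congrArg (K x t * ·) ht)

namespace SliceBound

theorem norm_integralOp_coeFn_le (hℓ : 0 < ℓ) (hK : SliceBound ℓ C K) (u : Lp ℂ 2 (μ₁ ℓ))
    (hx : x ≤ ℓ) : ‖integralOp K u x‖ ≤ C * ‖u‖ := by
  rw [Lp.norm_def, toReal_eLpNorm (Lp.aestronglyMeasurable u)]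
  exact hK.norm_integralOp_le hℓ hx (Lp.memLp u)

theorem exists_linearMap (hK : SliceBound ℓ C K) : ∃ L : Lp ℂ 2 (μ₁ ℓ) →ₗ[ℂ] Icc (0 : ℝ) ℓ → ℂ,
    ∀ u x, L u x = integralOp K u x := by
  have hint (u : Lp ℂ 2 (μ₁ ℓ)) (x : Icc (0 : ℝ) ℓ) :
      Integrable (fun t => K x t * u t) (μ₁ x) := by
    have hKx : SliceBound x C K := fun y hy => hK y ⟨hy.1, hy.2.trans x.2.2⟩
    exact hKx.memLp.integrable_mul ((Lp.memLp u).mono_measure (μ₁_mono x.2.2))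
  refine ⟨IsLinearMap.mk' (fun (u : Lp ℂ 2 (μ₁ ℓ)) (x : Icc (0 : ℝ) ℓ) => integralOp K u x)
    ⟨fun u v => funext fun x => ?_, fun c u => funext fun x => ?_⟩, fun _ _ => rfl⟩
  · rw [integralOp_congr_ae K (Lp.coeFn_add u v) x.2.2]
    simp only [integralOp, Pi.add_apply, mul_add]
    exact integral_add (hint u x) (hint v x)
  · rw [integralOp_congr_ae K (Lp.coeFn_smul c u) x.2.2]
    simp only [integralOp, Pi.smul_apply, smul_eq_mul, mul_left_comm, integral_const_mul]

theorem exists_isIntegralCLM (hℓ : 0 < ℓ) (hK : SliceBound ℓ C K)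
    (h : ∀ ρ, ContinuousOn (integralOp K (planeWave ρ)) (Icc 0 ℓ)) : ∃ J, IsIntegralCLM ℓ K J := by
  obtain ⟨L, hL⟩ := hK.exists_linearMap
  have hspan : Submodule.span ℂ (range fun ρ => (memLp_planeWave ρ ℓ).toLp (planeWave ρ)) ≤
      (continuousSubmodule (Icc (0 : ℝ) ℓ) ℂ ℂ).comap L := by
    rw [Submodule.span_le, range_subset_iff]
    intro ρ
    refine (h ρ).domRestrict.congr fun x => ?_
    rw [hL]
    exact (integralOp_congr_ae K (memLp_planeWave ρ ℓ).coeFn_toLp x.2.2).symm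
  have hbound (u : Lp ℂ 2 (μ₁ ℓ)) (x : Icc (0 : ℝ) ℓ) : ‖L u x‖ ≤ C * ‖u‖ := by
    rw [hL]
    exact hK.norm_integralOp_coeFn_le hℓ u x.2.2
  have hcont := continuous_apply_of_topologicalClosure_eq_top (hK.nonneg hℓ) hbound
    (topologicalClosure_span_planeWave ℓ) fun v hv => hspan hv
  let Lc : Lp ℂ 2 (μ₁ ℓ) →ₗ[ℂ] C(Icc (0 : ℝ) ℓ, ℂ) :=
    ⟨⟨fun u => ⟨L u, hcont u⟩, fun u v => ContinuousMap.ext fun x => by simp⟩,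
      fun c u => ContinuousMap.ext fun x => by simp⟩
  exact ⟨Lc.mkContinuous C fun u => (ContinuousMap.norm_le _
    (mul_nonneg (hK.nonneg hℓ) (norm_nonneg u))).2 (hbound u), hL⟩

end SliceBound

theorem IsIntegralCLM.norm_sub_le (hℓ : 0 < ℓ) (hJ : IsIntegralCLM ℓ K J)
    (hJ' : IsIntegralCLM ℓ K' J') (hK : ∀ x ∈ Icc 0 ℓ, MemLp (K x) 2 (μ₁ x))
    (hK' : ∀ x ∈ Icc 0 ℓ, MemLp (K' x) 2 (μ₁ x))
    (h : SliceBound ℓ C (K - K')) : ‖J - J'‖ ≤ C := by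
  refine (J - J').opNorm_le_bound (h.nonneg hℓ) fun u => ?_
  refine (ContinuousMap.norm_le _ (mul_nonneg (h.nonneg hℓ) (norm_nonneg u))).2 fun x => ?_
  have hx := x.2
  rw [sub_apply, ContinuousMap.sub_apply, hJ, hJ', ← integralOp_sub
    (hK x hx) (hK' x hx) ((Lp.memLp u).mono_measure (μ₁_mono hx.2))]
  exact h.norm_integralOp_coeFn_le hℓ u hx.2

theorem exists_restrictCLM (ℓ : ℝ) :
    ∃ R : Lp ℂ 2 (μ₁ ℓ) →L[ℂ] Lp ℂ 2 (μ₀ ℓ), ∀ u, R u =ᵐ[μ₀ ℓ] u := by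
  have hμ : (μ₁ ℓ).restrict (Ioo 0 ℓ) = μ₀ ℓ := by
    rw [μ₁, Measure.restrict_restrict measurableSet_Ioo, Ioo_inter_Ioo]
    rcases le_or_gt ℓ 0 with h | h
    · rw [Ioo_eq_empty, μ₀, Ioo_eq_empty h.not_gt]
      exact fun h' => (lt_min_iff.1 (h'.trans_le' le_sup_left)).1.not_ge h
    · rw [sup_of_le_left (by linarith), inf_idem]
  rw [← hμ]
  exact ⟨LpToLpRestrictCLM ℝ ℂ ℂ (μ₁ ℓ) 2 (Ioo 0 ℓ), LpToLpRestrictCLM_coeFn ℂ _⟩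

theorem exists_continuousMapToLp {a b : ℝ} (hab : a ≤ b) :
    ∃ E : C(Icc a b, ℂ) →L[ℂ] Lp ℂ 2 (volume.restrict (Ioo a b)),
      ∀ u : C(Icc a b, ℂ), E u =ᵐ[volume.restrict (Ioo a b)] IccExtend hab u := by
  let extend : BoundedContinuousFunction (Icc a b) ℂ →L[ℂ] BoundedContinuousFunction ℝ ℂ :=
    BoundedContinuousFunction.compContinuousCLM ℂ ℂ ⟨projIcc a b hab, continuous_projIcc⟩
  let bounded := (ContinuousMap.linearIsometryBoundedOfCompact (Icc a b) ℂ
    ℂ).toContinuousLinearEquiv.toContinuousLinearMap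
  exact ⟨BoundedContinuousFunction.toLp 2 (volume.restrict (Ioo a b)) ℂ ∘L extend ∘L bounded,
    fun u => BoundedContinuousFunction.coeFn_toLp _ _ _ (extend (bounded u))⟩

theorem IsImpedance.exists_isIntegralCLM (hℓ : 0 < ℓ) (hf : IsImpedance ℓ f) :
    ∃ J, IsIntegralCLM ℓ (transKernel (coeff ℓ f)) J := by
  obtain ⟨C, hC⟩ := exists_sliceBound_transKernel (hf.isCoeff hℓ.le) ℓ
  refine hC.exists_isIntegralCLM hℓ fun ρ => ?_
  have hy := (hf.isExpSolution hℓ.le ρ).memW12.continuousOn hℓ.le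
  exact (hy.sub (continuous_planeWave ρ).continuousOn).congr fun x _ =>
    (add_sub_cancel_left _ _).symm

theorem IsIntegralCLM.isTransmutationL2 (hℓ : 0 < ℓ) (hf : IsImpedance ℓ f)
    (hJ : IsIntegralCLM ℓ (transKernel (coeff ℓ f)) J)
    {R : Lp ℂ 2 (μ₁ ℓ) →L[ℂ] Lp ℂ 2 (μ₀ ℓ)} (hR : ∀ u, R u =ᵐ[μ₀ ℓ] u)
    {E : C(Icc (0 : ℝ) ℓ, ℂ) →L[ℂ] Lp ℂ 2 (μ₀ ℓ)}
    (hE : ∀ v : C(Icc (0 : ℝ) ℓ, ℂ), E v =ᵐ[μ₀ ℓ] IccExtend hℓ.le v) :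
    IsTransmutationL2 ℓ f (R + E ∘L J) := by
  intro u
  filter_upwards [Lp.coeFn_add (R u) (E (J u)), hR u, hE (J u),
    ae_restrict_mem measurableSet_Ioo] with x hadd hRx hEx hx
  have hx' := Ioo_subset_Icc_self hx
  rw [hf.transmute_eq hℓ.le _ hx']
  refine hadd.trans (congrArg₂ (· + ·) hRx (hEx.trans ?_))
  rw [IccExtend_of_mem _ _ hx', hJ]

theorem IsIntegralCLM.isTransmutationC (hℓ : 0 < ℓ) (hf : IsImpedance ℓ f)
    (hJ : IsIntegralCLM ℓ (transKernel (coeff ℓ f)) J)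
    {E : C(Icc (-ℓ) ℓ, ℂ) →L[ℂ] Lp ℂ 2 (μ₁ ℓ)}
    (hE : ∀ u : C(Icc (-ℓ) ℓ, ℂ), E u =ᵐ[μ₁ ℓ] IccExtend (neg_le_self hℓ.le) u) :
    IsTransmutationC ℓ hℓ f (ContinuousMap.compCLM ℂ ℂ
      (ContinuousMap.inclusion (Icc_subset_Icc_left (neg_nonpos.2 hℓ.le))) + J ∘L E) := by
  intro u x
  rw [hf.transmute_eq hℓ.le _ x.2, ← integralOp_congr_ae _ (hE u) x.2.2, ← hJ,
    IccExtend_of_mem _ _ (Icc_subset_Icc_left (neg_nonpos.2 hℓ.le) x.2)]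
  rfl

end Operator

section Convergence

variable {ℓ x δ : ℝ} {f g : ℝ → ℂ} {F : ℕ → ℝ → ℂ}

theorem IsImpedance.norm_apply_sub_le (hℓ : 0 ≤ ℓ) (hf : IsImpedance ℓ f) (hg : IsImpedance ℓ g)
    (hx : x ∈ Icc 0 ℓ) : ‖g x - f x‖ ≤ √ℓ * lpNorm (deriv g - deriv f) 2 (μ₀ ℓ) := by
  have hsub := hg.memW12.hasW12Deriv.sub hℓ hf.memW12.hasW12Deriv
  have hderiv := memLp_restrict_Ioc hx.2 hsub.memLp
  have hone : MemLp (fun _ => (1 : ℂ)) 2 (volume.restrict (Ioc 0 x)) := memLp_const 1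
  calc ‖g x - f x‖
      ≤ ∫ t in Ioc 0 x, ‖(1 : ℂ)‖ * ‖deriv g t - deriv f t‖ := by
        simpa only [norm_one, one_mul] using
          hsub.norm_le_integral hℓ (by rw [hg.normalized, hf.normalized, sub_self]) hx
    _ ≤ lpNorm (fun _ => (1 : ℂ)) 2 (volume.restrict (Ioc 0 x)) *
          lpNorm (deriv g - deriv f) 2 (volume.restrict (Ioc 0 x)) :=
        integral_norm_mul_norm_le_lpNorm hone hderiv
    _ ≤ √ℓ * lpNorm (deriv g - deriv f) 2 (μ₀ ℓ) := by
        refine mul_le_mul ?_ ?_ lpNorm_nonneg (Real.sqrt_nonneg _)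
        · refine (lpNorm_two_le_of_norm_le zero_le_one (ae_of_all _ fun _ => norm_one.le)).trans ?_
          rw [one_mul, measureReal_restrict_apply_univ, Real.volume_real_Ioc_of_le hx.1, sub_zero]
          exact Real.sqrt_le_sqrt hx.2
        · rw [restrict_Ioo_eq_restrict_Ioc.symm]
          exact lpNorm_mono_measure hsub.memLp
            (Measure.restrict_mono_set _ (Ioo_subset_Ioo_right hx.2))

theorem IsImpedance.norm_logD_sub_le (hℓ : 0 ≤ ℓ) (hf : IsImpedance ℓ f) (hg : IsImpedance ℓ g)
    (hδ : 0 < δ) (hfδ : ∀ x ∈ Icc 0 ℓ, δ ≤ ‖f x‖)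
    (hgδ : √ℓ * lpNorm (deriv g - deriv f) 2 (μ₀ ℓ) ≤ δ / 2) (hx : x ∈ Icc 0 ℓ) :
    ‖logD g x - logD f x‖ ≤ 2 / δ * (‖deriv g x - deriv f x‖ +
      √ℓ * lpNorm (deriv g - deriv f) 2 (μ₀ ℓ) * ‖logD f x‖) := by
  have hsub := hf.norm_apply_sub_le hℓ hg hx
  have hgx : δ / 2 ≤ ‖g x‖ := by
    linarith [hfδ x hx, norm_sub_rev (g x) (f x), norm_sub_norm_le (f x) (g x)]
  have heq : logD g x - logD f x =
      (g x)⁻¹ * (deriv g x - deriv f x - (g x - f x) * logD f x) := by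
    have hf0 := hf.ne_zero x hx
    have hg0 := hg.ne_zero x hx
    simp only [logD]
    field_simp
    ring
  rw [heq, norm_mul, norm_inv]
  refine mul_le_mul ?_ ((norm_sub_le _ _).trans ?_) (norm_nonneg _) (by positivity)
  · rw [← inv_div]
    exact inv_anti₀ (half_pos hδ) hgx
  · rw [norm_mul]
    gcongr

theorem IsImpedance.lpNorm_logD_sub_le (hℓ : 0 ≤ ℓ) (hf : IsImpedance ℓ f) (hg : IsImpedance ℓ g)
    (hδ : 0 < δ) (hfδ : ∀ x ∈ Icc 0 ℓ, δ ≤ ‖f x‖)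
    (hgδ : √ℓ * lpNorm (deriv g - deriv f) 2 (μ₀ ℓ) ≤ δ / 2) :
    lpNorm (logD g - logD f) 2 (μ₀ ℓ) ≤ 2 / δ * (1 + √ℓ * lpNorm (logD f) 2 (μ₀ ℓ)) *
      lpNorm (deriv g - deriv f) 2 (μ₀ ℓ) := by
  set d := lpNorm (deriv g - deriv f) 2 (μ₀ ℓ)
  have hsub : MemLp (fun x => deriv g x - deriv f x) 2 (μ₀ ℓ) :=
    hg.memW12.deriv_memLp.sub hf.memW12.deriv_memLp
  have hd : MemLp (fun x => ‖deriv g x - deriv f x‖) 2 (μ₀ ℓ) := hsub.norm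
  have hl : MemLp (fun x => √ℓ * d * ‖logD f x‖) 2 (μ₀ ℓ) := (hf.memLp_logD hℓ).norm.const_mul _
  have hle : ∀ᵐ x ∂μ₀ ℓ, ‖(logD g - logD f) x‖ ≤
      2 / δ * (‖deriv g x - deriv f x‖ + √ℓ * d * ‖logD f x‖) := by
    filter_upwards [ae_restrict_mem measurableSet_Ioo] with x hx
    exact hf.norm_logD_sub_le hℓ hg hδ hfδ hgδ (Ioo_subset_Icc_self hx)
  refine (lpNorm_mono_ae ((hd.add hl).const_mul (2 / δ)) (hle.mono fun x hx =>
    hx.trans (Real.le_norm_self _))).trans ?_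
  rw [lpNorm_const_mul, Real.norm_of_nonneg (by positivity), mul_assoc]
  refine mul_le_mul_of_nonneg_left ((lpNorm_add_le hd one_le_two).trans_eq ?_) (by positivity)
  have hd0 : 0 ≤ √ℓ * d := mul_nonneg (Real.sqrt_nonneg _) lpNorm_nonneg
  have hnorm : lpNorm (fun x => ‖deriv g x - deriv f x‖) 2 (μ₀ ℓ) = d := lpNorm_norm hsub.1 2
  rw [lpNorm_const_mul, hnorm, lpNorm_norm (hf.memLp_logD hℓ).1, Real.norm_of_nonneg hd0]
  ring

theorem IsImpedance.exists_pos_le_norm (hℓ : 0 ≤ ℓ) (hf : IsImpedance ℓ f) :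
    ∃ δ > 0, ∀ x ∈ Icc 0 ℓ, δ ≤ ‖f x‖ := by
  obtain ⟨x, hx, hmin⟩ := isCompact_Icc.exists_isMinOn (nonempty_Icc.2 hℓ)
    (hf.memW12.continuousOn hℓ).norm
  exact ⟨‖f x‖, norm_pos_iff.2 (hf.ne_zero x hx), fun y hy => hmin hy⟩

theorem TendstoL2.tendsto_lpNorm {u : ℕ → ℝ → ℂ} {v : ℝ → ℂ} (h : TendstoL2 ℓ u v)
    (hu : ∀ n, MemLp (u n) 2 (μ₀ ℓ)) (hv : MemLp v 2 (μ₀ ℓ)) :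
    Tendsto (fun n => lpNorm (u n - v) 2 (μ₀ ℓ)) atTop (𝓝 0) := by
  have h' := (ENNReal.tendsto_toReal ENNReal.zero_ne_top).comp h
  exact h'.congr fun n => toReal_eLpNorm ((hu n).sub hv).1

theorem IsImpedance.tendsto_lpNorm_logD_sub (hℓ : 0 ≤ ℓ) (hf : IsImpedance ℓ f)
    (hF : ∀ n, IsImpedance ℓ (F n)) (h : TendstoL2 ℓ (fun n => deriv (F n)) (deriv f)) :
    Tendsto (fun n => lpNorm (logD (F n) - logD f) 2 (μ₀ ℓ)) atTop (𝓝 0) := by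
  obtain ⟨δ, hδ, hfδ⟩ := hf.exists_pos_le_norm hℓ
  have hd := h.tendsto_lpNorm (fun n => (hF n).memW12.deriv_memLp) hf.memW12.deriv_memLp
  have hsmall : ∀ᶠ n in atTop, √ℓ * lpNorm (deriv (F n) - deriv f) 2 (μ₀ ℓ) ≤ δ / 2 := by
    have h0 := hd.const_mul √ℓ
    rw [mul_zero] at h0
    exact h0.eventually_le_const (half_pos hδ)
  have hlim := hd.const_mul (2 / δ * (1 + √ℓ * lpNorm (logD f) 2 (μ₀ ℓ)))
  rw [mul_zero] at hlim
  exact squeeze_zero' (Eventually.of_forall fun _ => lpNorm_nonneg)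
    (hsmall.mono fun n hn => hf.lpNorm_logD_sub_le hℓ (hF n) hδ hfδ hn) hlim

theorem IsImpedance.exists_tendsto_sliceBound_sub (hℓ : 0 ≤ ℓ) (hf : IsImpedance ℓ f)
    (hF : ∀ n, IsImpedance ℓ (F n)) (h : TendstoL2 ℓ (fun n => deriv (F n)) (deriv f)) :
    ∃ C : ℕ → ℝ, Tendsto C atTop (𝓝 0) ∧ ∀ᶠ n in atTop,
      SliceBound ℓ (C n) (transKernel (coeff ℓ (F n)) - transKernel (coeff ℓ f)) := by
  have hlog := hf.tendsto_lpNorm_logD_sub hℓ hF h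
  have hlim := hlog.const_mul (2 * sliceConst (lpNorm (logD f) 2 (μ₀ ℓ) + 1) ℓ)
  rw [mul_zero] at hlim
  refine ⟨_, hlim, (hlog.eventually_le_const one_pos).mono fun n hn => ?_⟩
  rw [← lpNorm_coeff_sub]
  refine sliceBound_transKernel_sub ((hF n).isCoeff hℓ) (hf.isCoeff hℓ) ?_ ?_
  · rw [lpNorm_coeff]
    have htri := lpNorm_add_le (((hF n).memLp_logD hℓ).sub (hf.memLp_logD hℓ)) one_le_two
      (g := logD f)
    rw [sub_add_cancel] at htri
    linarith
  · rw [lpNorm_coeff]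
    linarith

theorem IsIntegralCLM.tendsto (hℓ : 0 < ℓ) (hf : IsImpedance ℓ f)
    (hF : ∀ n, IsImpedance ℓ (F n)) (h : TendstoL2 ℓ (fun n => deriv (F n)) (deriv f))
    {J : Lp ℂ 2 (μ₁ ℓ) →L[ℂ] C(Icc (0 : ℝ) ℓ, ℂ)}
    {Jn : ℕ → Lp ℂ 2 (μ₁ ℓ) →L[ℂ] C(Icc (0 : ℝ) ℓ, ℂ)}
    (hJ : IsIntegralCLM ℓ (transKernel (coeff ℓ f)) J)
    (hJn : ∀ n, IsIntegralCLM ℓ (transKernel (coeff ℓ (F n))) (Jn n)) :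
    Tendsto Jn atTop (𝓝 J) := by
  obtain ⟨C, hC, hbound⟩ := hf.exists_tendsto_sliceBound_sub hℓ.le hF h
  have hmem {g : ℝ → ℂ} (hg : IsImpedance ℓ g) (x : ℝ) :
      MemLp (transKernel (coeff ℓ g) x) 2 (μ₁ x) :=
    (exists_sliceBound_transKernel (hg.isCoeff hℓ.le) x).choose_spec.memLp
  refine (tendsto_iff_norm_sub_tendsto_zero (E := Lp ℂ 2 (μ₁ ℓ) →L[ℂ] C(Icc (0 : ℝ) ℓ, ℂ))).2 ?_
  exact squeeze_zero' (Eventually.of_forall fun n => norm_nonneg (Jn n - J)) (hbound.mono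
    fun n hn => (hJn n).norm_sub_le hℓ hJ (fun x _ => hmem (hF n) x) (fun x _ => hmem hf x) hn) hC

theorem IsImpedance.exists_isTransmutationL2_tendsto (hℓ : 0 < ℓ) (hf : IsImpedance ℓ f)
    (hF : ∀ n, IsImpedance ℓ (F n)) (h : TendstoL2 ℓ (fun n => deriv (F n)) (deriv f)) :
    ∃ (T : Lp ℂ 2 (μ₁ ℓ) →L[ℂ] Lp ℂ 2 (μ₀ ℓ)) (Tn : ℕ → Lp ℂ 2 (μ₁ ℓ) →L[ℂ] Lp ℂ 2 (μ₀ ℓ)),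
      IsTransmutationL2 ℓ f T ∧ (∀ n, IsTransmutationL2 ℓ (F n) (Tn n)) ∧
      Tendsto Tn atTop (𝓝 T) := by
  obtain ⟨J, hJ⟩ := hf.exists_isIntegralCLM hℓ
  choose Jn hJn using fun n => (hF n).exists_isIntegralCLM hℓ
  obtain ⟨R, hR⟩ := exists_restrictCLM ℓ
  obtain ⟨E, hE⟩ := exists_continuousMapToLp hℓ.le
  exact ⟨_, _, hJ.isTransmutationL2 hℓ hf hR hE,
    fun n => (hJn n).isTransmutationL2 hℓ (hF n) hR hE,
    ((continuous_const.clm_comp continuous_id).tendsto J |>.comp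
      (IsIntegralCLM.tendsto hℓ hf hF h hJ hJn)).const_add R⟩

theorem IsImpedance.exists_isTransmutationC_tendsto (hℓ : 0 < ℓ) (hf : IsImpedance ℓ f)
    (hF : ∀ n, IsImpedance ℓ (F n)) (h : TendstoL2 ℓ (fun n => deriv (F n)) (deriv f)) :
    ∃ (S : C(Icc (-ℓ) ℓ, ℂ) →L[ℂ] C(Icc (0 : ℝ) ℓ, ℂ))
      (Sn : ℕ → C(Icc (-ℓ) ℓ, ℂ) →L[ℂ] C(Icc (0 : ℝ) ℓ, ℂ)),
      IsTransmutationC ℓ hℓ f S ∧ (∀ n, IsTransmutationC ℓ hℓ (F n) (Sn n)) ∧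
      Tendsto Sn atTop (𝓝 S) := by
  obtain ⟨J, hJ⟩ := hf.exists_isIntegralCLM hℓ
  choose Jn hJn using fun n => (hF n).exists_isIntegralCLM hℓ
  obtain ⟨E, hE⟩ := exists_continuousMapToLp (neg_le_self hℓ.le)
  exact ⟨_, _, hJ.isTransmutationC hℓ hf hE, fun n => (hJn n).isTransmutationC hℓ (hF n) hE,
    ((continuous_id.clm_comp (continuous_const (y := E))).tendsto J |>.comp
      (IsIntegralCLM.tendsto hℓ hf hF h hJ hJn)).const_add _⟩

theorem IsImpedance.exists_kernel_toLp_tendsto (hℓ : 0 ≤ ℓ) (hf : IsImpedance ℓ f)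
    (hF : ∀ n, IsImpedance ℓ (F n)) (h : TendstoL2 ℓ (fun n => deriv (F n)) (deriv f)) :
    ∃ (k : Lp ℂ 2 (μT ℓ)) (kn : ℕ → Lp ℂ 2 (μT ℓ)),
      k =ᵐ[μT ℓ] (fun p => kernel ℓ f p.1 p.2) ∧
      (∀ n, kn n =ᵐ[μT ℓ] (fun p => kernel ℓ (F n) p.1 p.2)) ∧ Tendsto kn atTop (𝓝 k) := by
  have hk := (hf.isTransmutationKernel_kernel hℓ).memLp
  have hkn n := ((hF n).isTransmutationKernel_kernel hℓ).memLp
  refine ⟨hk.toLp, fun n => (hkn n).toLp, hk.coeFn_toLp, fun n => (hkn n).coeFn_toLp, ?_⟩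
  obtain ⟨C, hC, hbound⟩ := hf.exists_tendsto_sliceBound_sub hℓ hF h
  rw [Lp.tendsto_Lp_iff_tendsto_eLpNorm'']
  have hlim := ENNReal.tendsto_ofReal (hC.mul_const √ℓ)
  rw [zero_mul, ENNReal.ofReal_zero] at hlim
  refine tendsto_of_tendsto_of_tendsto_of_le_of_le' tendsto_const_nhds hlim
    (Eventually.of_forall fun _ => zero_le) (hbound.mono fun n hn => ?_)
  have hn' : SliceBound ℓ (C n) (kernel ℓ (F n) - kernel ℓ f) := hn.congr fun x hx =>
    ((hF n).transKernel_ae_eq_kernel hℓ hx).sub (hf.transKernel_ae_eq_kernel hℓ hx)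
  have hle := hn'.eLpNorm_μT_le hℓ ((hkn n).sub hk).1
  exact hle

end Convergence

end Transmutation

end

theorem mainTheorem11_general (ℓ : ℝ) (hℓ : 0 < ℓ) (f : ℝ → ℂ) (F : ℕ → ℝ → ℂ)
    (hf : Transmutation.IsImpedance ℓ f) (hF : ∀ n, Transmutation.IsImpedance ℓ (F n))
    (hconv : Transmutation.TendstoL2 ℓ (fun n => deriv (F n)) (deriv f)) :
    (Transmutation.IsUniqueTransmutationKernel ℓ f (Transmutation.kernel ℓ f) ∧
      ∀ n, Transmutation.IsUniqueTransmutationKernel ℓ (F n) (Transmutation.kernel ℓ (F n))) ∧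
    (∃ (T : Lp ℂ 2 (Transmutation.μ₁ ℓ) →L[ℂ] Lp ℂ 2 (Transmutation.μ₀ ℓ))
      (Tn : ℕ → Lp ℂ 2 (Transmutation.μ₁ ℓ) →L[ℂ] Lp ℂ 2 (Transmutation.μ₀ ℓ)),
      Transmutation.IsTransmutationL2 ℓ f T ∧
      (∀ n, Transmutation.IsTransmutationL2 ℓ (F n) (Tn n)) ∧
      Tendsto Tn atTop (𝓝 T)) ∧
    (∃ (S : C(Icc (-ℓ) ℓ, ℂ) →L[ℂ] C(Icc (0 : ℝ) ℓ, ℂ))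
      (Sn : ℕ → C(Icc (-ℓ) ℓ, ℂ) →L[ℂ] C(Icc (0 : ℝ) ℓ, ℂ)),
      Transmutation.IsTransmutationC ℓ hℓ f S ∧
      (∀ n, Transmutation.IsTransmutationC ℓ hℓ (F n) (Sn n)) ∧
      Tendsto Sn atTop (𝓝 S)) ∧
    (∃ (k : Lp ℂ 2 (Transmutation.μT ℓ)) (kn : ℕ → Lp ℂ 2 (Transmutation.μT ℓ)),
      k =ᵐ[Transmutation.μT ℓ] (fun p => Transmutation.kernel ℓ f p.1 p.2) ∧
      (∀ n, kn n =ᵐ[Transmutation.μT ℓ] (fun p => Transmutation.kernel ℓ (F n) p.1 p.2)) ∧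
      Tendsto kn atTop (𝓝 k)) :=
  ⟨⟨hf.isUniqueTransmutationKernel hℓ.le, fun n => (hF n).isUniqueTransmutationKernel hℓ.le⟩,
    hf.exists_isTransmutationL2_tendsto hℓ hF hconv,
    hf.exists_isTransmutationC_tendsto hℓ hF hconv,
    hf.exists_kernel_toLp_tendsto hℓ.le hF hconv⟩

theorem mainTheorem11 (ℓ : ℝ) (hℓ : 0 < ℓ) (f : ℝ → ℂ) (F : ℕ → ℝ → ℂ)
    (hf : Transmutation.IsImpedance ℓ f)
    (hF : ∀ n, Transmutation.IsImpedance ℓ (F n))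
    (hFsmooth : ∀ n, ContDiffOn ℝ ∞ (F n) (Icc 0 ℓ))
    (hconv : Transmutation.ImpedanceTendsto ℓ F f) :
    -- the kernels `K_f` and `K_{F n}` exist and are unique
    (Transmutation.IsUniqueTransmutationKernel ℓ f (Transmutation.kernel ℓ f) ∧
      ∀ n, Transmutation.IsUniqueTransmutationKernel ℓ (F n) (Transmutation.kernel ℓ (F n))) ∧
    -- strong operator convergence in `B(L²(-ℓ, ℓ), L²(0, ℓ))`
    (∃ (T : Lp ℂ 2 (Transmutation.μ₁ ℓ) →L[ℂ] Lp ℂ 2 (Transmutation.μ₀ ℓ))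
      (Tn : ℕ → Lp ℂ 2 (Transmutation.μ₁ ℓ) →L[ℂ] Lp ℂ 2 (Transmutation.μ₀ ℓ)),
      Transmutation.IsTransmutationL2 ℓ f T ∧
      (∀ n, Transmutation.IsTransmutationL2 ℓ (F n) (Tn n)) ∧
      ∀ u, Tendsto (fun n => Tn n u) atTop (𝓝 (T u))) ∧
    -- strong operator convergence in `B(C[-ℓ, ℓ], C[0, ℓ])`
    (∃ (S : C(Icc (-ℓ) ℓ, ℂ) →L[ℂ] C(Icc (0 : ℝ) ℓ, ℂ))
      (Sn : ℕ → C(Icc (-ℓ) ℓ, ℂ) →L[ℂ] C(Icc (0 : ℝ) ℓ, ℂ)),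
      Transmutation.IsTransmutationC ℓ hℓ f S ∧
      (∀ n, Transmutation.IsTransmutationC ℓ hℓ (F n) (Sn n)) ∧
      ∀ u, Tendsto (fun n => Sn n u) atTop (𝓝 (S u))) ∧
    -- weak convergence of the kernels in `L²` of the triangle
    (∃ (k : Lp ℂ 2 (Transmutation.μT ℓ)) (kn : ℕ → Lp ℂ 2 (Transmutation.μT ℓ)),
      k =ᵐ[Transmutation.μT ℓ] (fun p => Transmutation.kernel ℓ f p.1 p.2) ∧
      (∀ n, kn n =ᵐ[Transmutation.μT ℓ] (fun p => Transmutation.kernel ℓ (F n) p.1 p.2)) ∧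
      Tendsto (fun n => toWeakSpace ℂ (Lp ℂ 2 (Transmutation.μT ℓ)) (kn n)) atTop
        (𝓝 (toWeakSpace ℂ (Lp ℂ 2 (Transmutation.μT ℓ)) k))) := by
  obtain ⟨hunique, ⟨T, Tn, hT, hTn, hTconv⟩, ⟨S, Sn, hS, hSn, hSconv⟩, k, kn, hk, hkn, hkconv⟩ :=
    mainTheorem11_general ℓ hℓ f F hf hF hconv.tendsto.2
  exact ⟨hunique, ⟨T, Tn, hT, hTn, fun u => ((continuous_eval_const u).tendsto T).comp hTconv⟩,
    ⟨S, Sn, hS, hSn, fun u => ((continuous_eval_const u).tendsto S).comp hSconv⟩,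
    k, kn, hk, hkn, ((toWeakSpaceCLM ℂ _).continuous.tendsto k).comp hkconv⟩
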